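/- Let $M$ be a smooth manifold (finite-dimensional, without boundary, Hausdorff, $\sigma$-compact), $K\to M$ a Lie algebra bundle (a smooth vector bundle of finite rank whose fibres are Lie algebras and which is locally trivial as a bundle of Lie algebras), and $\bar A\to M$ a Lie algebroid of finite rank. Notation. $\Gamma$ denotes smooth sections. $\mathrm{CDO}[K]$ is the Lie algebroid whose sections are the pairs of an $\mathbb R$-linear operator $D:\Gamma K\to\Gamma K$ and a vector field $\delta$ (its anchor) with $D(fV)=fD(V)+\delta(f)V$ and $D[V,W]=[DV,W]+[V,DW]$, with the commutator bracket. $\mathrm{ad}(K)$ is the image of $\mathrm{ad}:K\to\mathrm{Der}(K)$, a smooth vector bundle, and $\mathrm{OutDO}[K]=\mathrm{CDO}[K]/\mathrm{ad}(K)$. A *coupling* of $\bar A$ with $K$ is a morphism of Lie algebroids $\Xi:\bar A\to\mathrm{OutDO}[K]$. A *Lie derivation law covering $\Xi$* is a vector bundle morphism $\nabla:\bar A\to\mathrm{CDO}[K]$ whose composition with the projection $\mathrm{CDO}[K]\to\mathrm{OutDO}[K]$ is $\Xi$; its curvature is $R_\nabla(X,Y)=\nabla_{[X,Y]}-[\nabla_X,\nabla_Y]$.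 A *crossed module of Lie algebroids* $(K,\tau,A,\rho)$ consists of a transitive Lie algebroid $A$ over $M$, a morphism of Lie algebroids $\tau:K\to A$ and a representation $\rho:A\to\mathrm{CDO}[K]$ such that $\rho(\tau V)(W)=[V,W]$ and $\tau(\rho(X)(V))=[X,\tau V]$ for all $X\in\Gamma A$, $V,W\in\Gamma K$. It is a *coupling crossed module of $\bar A$ with $K$* if moreover $\ker\tau$ is the centre $ZK$ of $K$ and $\bar A$ is the quotient Lie algebroid $A/\operatorname{im}\tau$, with projection $\pi:A\to\bar A$. It *induces* the coupling $\Xi$ if $\Xi(\pi X)$ is the class of $\rho(X)$ in $\Gamma\,\mathrm{OutDO}[K]$ for all $X\in\Gamma A$. Two coupling crossed modules $(K,\tau,A,\rho)$ and $(K,\tau',A',\rho')$ of $\bar A$ with $K$, with projections $\pi,\pi'$, are *equivalent* if there is a morphism of Lie algebroids $\theta:A\to A'$ with $\theta\circ\tau=\tau'$, $\pi'\circ\theta=\pi$ and $\rho'\circ\theta=\rho$. Statement. (1) Let $\Xi:\bar A\to\mathrm{OutDO}[K]$ be a coupling. There is a Lie derivation law covering $\Xi$. Let $\nabla$ be any such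 law. Then there is exactly one Lie algebroid structure on the vector bundle $A=\bar A\oplus\mathrm{ad}(K)$ whose anchor is the anchor of $\bar A$ on the first summand and zero on the second, and whose bracket satisfies $$[X\oplus\mathrm{ad}_V,\,Y\oplus\mathrm{ad}_W]=[X,Y]\oplus\bigl(\mathrm{ad}_{\nabla_XW}-\mathrm{ad}_{\nabla_YV}+\mathrm{ad}_{[V,W]}-R_\nabla(X,Y)\bigr)$$ for all $X,Y\in\Gamma\bar A$ and $V,W\in\Gamma K$. With this structure, $\tau:K\to A$, $\tau(V)=0\oplus\mathrm{ad}_V$, is a morphism of Lie algebroids, $\rho:A\to\mathrm{CDO}[K]$, $\rho(X\oplus\mathrm{ad}_V)(W)=\nabla_XW+[V,W]$, is a representation, and $\Xi(X)$ is the class of $\rho(X\oplus\mathrm{ad}_V)$. If $\bar A$ is transitive, then $(K,\tau,A,\rho)$ is a coupling crossed module of $\bar A$ with $K$, with $\pi:A\to\bar A$ the first projection; it induces $\Xi$. (2) Every coupling crossed module of $\bar A$ with $K$ induces exactly one coupling of $\bar A$ with $K$, and two coupling crossed modules of $\bar A$ with $K$ are equivalent if and only if they induce the same coupling. Hence, for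 transitive $\bar A$, couplings of $\bar A$ with $K$ correspond bijectively to equivalence classes of coupling crossed modules of $\bar A$ with $K$. -/

import Mathlib

open Bundle Set
open scoped Manifold ContDiff

set_option linter.unusedSectionVars false

namespace Algd

noncomputable section

section Basic

variable {E : Type*} [NormedAddCommGroup E] [NormedSpace ℝ E] {H : Type*} [TopologicalSpace H]
  (I : ModelWithCorners ℝ E H) {M : Type*} [TopologicalSpace M] [ChartedSpace H M]

/-- The smooth sections of a vector bundle form a module over the smooth functions. -/
instance sectionModule {F : Type*} [NormedAddCommGroup F] [NormedSpace ℝ F] {A : M → Type*}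
    [TopologicalSpace (TotalSpace F A)] [∀ x, TopologicalSpace (A x)] [FiberBundle F A]
    [∀ x, AddCommGroup (A x)] [∀ x, Module ℝ (A x)] [VectorBundle ℝ F A] :
    Module C^∞⟮I, M; ℝ⟯ Cₛ^∞⟮I; F, A⟯ where
  smul f s := ⟨fun x => f x • s x, f.contMDiff.smul_section s.contMDiff⟩
  one_smul s := by ext x; exact one_smul ℝ (s x)
  mul_smul f g s := by ext x; exact mul_smul (f x) (g x) (s x)
  smul_zero f := by ext x; exact smul_zero (f x)
  smul_add f s t := by ext x; exact smul_add (f x) (s x) (t x)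
  add_smul f g s := by ext x; exact add_smul (f x) (g x) (s x)
  zero_smul s := by ext x; exact zero_smul ℝ (s x)

variable {F : Type*} [NormedAddCommGroup F] [NormedSpace ℝ F] {A : M → Type*}
    [TopologicalSpace (TotalSpace F A)] [∀ x, TopologicalSpace (A x)] [FiberBundle F A]
    [∀ x, AddCommGroup (A x)] [∀ x, Module ℝ (A x)] [VectorBundle ℝ F A]

theorem smul_section_apply (f : C^∞⟮I, M; ℝ⟯) (s : Cₛ^∞⟮I; F, A⟯) (x : M) :
    (f • s) x = f x • s x := rfl

instance sectionTower : IsScalarTower ℝ C^∞⟮I, M; ℝ⟯ Cₛ^∞⟮I; F, A⟯ where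
  smul_assoc c f s := by ext x; exact smul_assoc c (f x) (s x)

instance sectionComm : SMulCommClass ℝ C^∞⟮I, M; ℝ⟯ Cₛ^∞⟮I; F, A⟯ where
  smul_comm c f s := by ext x; exact smul_comm c (f x) (s x)

/-- A morphism of smooth vector bundles over the identity of the base. -/
structure VBMap (F₁ : Type*) [NormedAddCommGroup F₁] [NormedSpace ℝ F₁] (A₁ : M → Type*)
    [TopologicalSpace (TotalSpace F₁ A₁)] [∀ x, TopologicalSpace (A₁ x)] [FiberBundle F₁ A₁]
    [∀ x, AddCommGroup (A₁ x)] [∀ x, Module ℝ (A₁ x)]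
    (F₂ : Type*) [NormedAddCommGroup F₂] [NormedSpace ℝ F₂] (A₂ : M → Type*)
    [TopologicalSpace (TotalSpace F₂ A₂)] [∀ x, TopologicalSpace (A₂ x)] [FiberBundle F₂ A₂]
    [∀ x, AddCommGroup (A₂ x)] [∀ x, Module ℝ (A₂ x)] where
  toFun : ∀ x, A₁ x →ₗ[ℝ] A₂ x
  contMDiff_toFun : ContMDiff (I.prod 𝓘(ℝ, F₁)) (I.prod 𝓘(ℝ, F₂)) ∞
    (fun v : TotalSpace F₁ A₁ => (⟨v.proj, toFun v.proj v.2⟩ : TotalSpace F₂ A₂))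

variable {I}
variable {F₁ : Type*} [NormedAddCommGroup F₁] [NormedSpace ℝ F₁] {A₁ : M → Type*}
    [TopologicalSpace (TotalSpace F₁ A₁)] [∀ x, TopologicalSpace (A₁ x)] [FiberBundle F₁ A₁]
    [∀ x, AddCommGroup (A₁ x)] [∀ x, Module ℝ (A₁ x)] [VectorBundle ℝ F₁ A₁]
    {F₂ : Type*} [NormedAddCommGroup F₂] [NormedSpace ℝ F₂] {A₂ : M → Type*}
    [TopologicalSpace (TotalSpace F₂ A₂)] [∀ x, TopologicalSpace (A₂ x)] [FiberBundle F₂ A₂]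
    [∀ x, AddCommGroup (A₂ x)] [∀ x, Module ℝ (A₂ x)] [VectorBundle ℝ F₂ A₂]

/-- The action of a vector bundle morphism on smooth sections. -/
def VBMap.onSections (φ : VBMap I F₁ A₁ F₂ A₂) :
    Cₛ^∞⟮I; F₁, A₁⟯ →ₗ[C^∞⟮I, M; ℝ⟯] Cₛ^∞⟮I; F₂, A₂⟯ where
  toFun s := ⟨fun x => φ.toFun x (s x), φ.contMDiff_toFun.comp s.contMDiff⟩
  map_add' s t := by ext x; exact map_add (φ.toFun x) (s x) (t x)
  map_smul' f s := by ext x; exact map_smul (φ.toFun x) (f x) (s x)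

variable [IsManifold I ∞ M]

/-- A vector field as a derivation of the smooth functions, `f ↦ (x ↦ df_x (Y x))`. -/
def vectorFieldDerivation :
    Cₛ^∞⟮I; E, (TangentSpace I : M → Type _)⟯ →ₗ[C^∞⟮I, M; ℝ⟯]
      Derivation ℝ C^∞⟮I, M; ℝ⟯ C^∞⟮I, M; ℝ⟯ where
  toFun Y := Derivation.mk'
    { toFun := fun f => ⟨fun x => mvfderiv I f x (Y x), by
        have h := (f.contMDiff.contMDiff_tangentMap (m := ∞) (by simp)).comp Y.contMDiff
        intro x
        have h2 := (contMDiffAt_totalSpace.1 (h x)).2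
        have h3 : ContMDiffAt I 𝓘(ℝ, ℝ) ∞ (fun x => mfderiv I 𝓘(ℝ, ℝ) f x (Y x)) x := by
          simpa using h2
        exact h3⟩
      map_add' := fun f g => by
        ext x
        have hf := f.contMDiff.mdifferentiable (by simp) x
        have hg := g.contMDiff.mdifferentiable (by simp) x
        exact congrArg (fun L => L (Y x)) (mvfderiv_add hf hg)
      map_smul' := fun c f => by
        ext x
        have hf := f.contMDiff.mdifferentiable (by simp) x
        have := mvfderiv_smul (a := fun _ => c) (g := f) (mdifferentiableAt_const) hf
        have h := congrArg (fun L => L (Y x)) this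
        simp only [mvfderiv_const] at h
        refine h.trans ?_
        simp
        rfl }
    (fun f g => by
        ext x
        have hf := f.contMDiff.mdifferentiable (by simp) x
        have hg := g.contMDiff.mdifferentiable (by simp) x
        exact congrArg (fun L => L (Y x)) (mvfderiv_mul hf hg))
  map_add' Y Z := by
    ext f x
    exact map_add (mvfderiv I f x) (Y x) (Z x)
  map_smul' g Y := by
    ext f x
    exact map_smul (mvfderiv I f x) (g x) (Y x)


variable (I F A) in
/-- A Lie algebroid structure on a smooth vector bundle `A`. -/
@[ext]
structure LieAlgebroid where
  /-- the anchor `A → TM` -/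
  anchor : VBMap I F A E (TangentSpace I : M → Type _)
  /-- the bracket of sections, bilinear over `ℝ` -/
  bracket : Cₛ^∞⟮I; F, A⟯ →ₗ[ℝ] Cₛ^∞⟮I; F, A⟯ →ₗ[ℝ] Cₛ^∞⟮I; F, A⟯
  bracket_self : ∀ X, bracket X X = 0
  jacobi : ∀ X Y Z, bracket X (bracket Y Z) = bracket (bracket X Y) Z + bracket Y (bracket X Z)
  bracket_smul : ∀ (X : Cₛ^∞⟮I; F, A⟯) (f : C^∞⟮I, M; ℝ⟯) (Y : Cₛ^∞⟮I; F, A⟯),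
    bracket X (f • Y) = f • bracket X Y + vectorFieldDerivation (anchor.onSections X) f • Y
  anchor_bracket : ∀ X Y, vectorFieldDerivation (anchor.onSections (bracket X Y)) =
    ⁅vectorFieldDerivation (anchor.onSections X), vectorFieldDerivation (anchor.onSections Y)⁆

/-- The derivation of the smooth functions given by the anchor of a section. -/
def LieAlgebroid.anchorDerivation (𝒜 : LieAlgebroid I F A) :
    Cₛ^∞⟮I; F, A⟯ →ₗ[C^∞⟮I, M; ℝ⟯] Derivation ℝ C^∞⟮I, M; ℝ⟯ C^∞⟮I, M; ℝ⟯ :=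
  vectorFieldDerivation ∘ₗ 𝒜.anchor.onSections

/-- A Lie algebroid is transitive if its anchor is fibrewise surjective. -/
def LieAlgebroid.IsTransitive (𝒜 : LieAlgebroid I F A) : Prop :=
  ∀ x, Function.Surjective (𝒜.anchor.toFun x)

/-- A vector bundle morphism over the identity is a morphism of Lie algebroids if it commutes with
the anchors and preserves the brackets of sections. -/
structure IsLieAlgebroidMorphism (𝒜₁ : LieAlgebroid I F₁ A₁) (𝒜₂ : LieAlgebroid I F₂ A₂)
    (φ : VBMap I F₁ A₁ F₂ A₂) : Prop where
  anchor_comp : ∀ x (v : A₁ x), 𝒜₂.anchor.toFun x (φ.toFun x v) = 𝒜₁.anchor.toFun x v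
  map_bracket : ∀ X Y, φ.onSections (𝒜₁.bracket X Y) =
    𝒜₂.bracket (φ.onSections X) (φ.onSections Y)

end Basic

section Bundle

variable {E : Type*} [NormedAddCommGroup E] [NormedSpace ℝ E] {H : Type*} [TopologicalSpace H]
  (I : ModelWithCorners ℝ E H) {M : Type*} [TopologicalSpace M] [ChartedSpace H M]
  (F : Type*) [NormedAddCommGroup F] [NormedSpace ℝ F] (K : M → Type*)
  [TopologicalSpace (TotalSpace F K)] [∀ x, TopologicalSpace (K x)] [FiberBundle F K]
  [∀ x, LieRing (K x)] [∀ x, LieAlgebra ℝ (K x)]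

variable {F K} in
/-- A smooth local trivialization of `K` which is on each fibre an isomorphism of Lie algebras onto
`F` with the bracket `β`. -/
structure IsLieTrivialization (β : F →L[ℝ] F →L[ℝ] F) (e : Trivialization F (π F K)) : Prop where
  isLinear : e.IsLinear ℝ
  contMDiffOn : ContMDiffOn (I.prod 𝓘(ℝ, F)) (I.prod 𝓘(ℝ, F)) ∞ e e.source
  contMDiffOn_symm : ContMDiffOn (I.prod 𝓘(ℝ, F)) (I.prod 𝓘(ℝ, F)) ∞
    e.toOpenPartialHomeomorph.symm e.target
  map_lie : ∀ x ∈ e.baseSet, ∀ v w : K x, (e ⟨x, ⁅v, w⁆⟩).2 = β (e ⟨x, v⟩).2 (e ⟨x, w⟩).2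

/-- A Lie algebra bundle: a smooth vector bundle whose fibres are Lie algebras, locally trivial as
a bundle of Lie algebras with typical fibre `F` carrying the bracket `modelBracket` (which is then
automatically a Lie bracket, being transported from the fibres). -/
class LieAlgebraBundle where
  modelBracket : F →L[ℝ] F →L[ℝ] F
  exists_trivialization : ∀ x₀ : M, ∃ e : Trivialization F (π F K),
    IsLieTrivialization I modelBracket e ∧ x₀ ∈ e.baseSet

variable {I F K}

theorem IsLieTrivialization.contMDiffAt_section_iff {β : F →L[ℝ] F →L[ℝ] F}
    {e : Trivialization F (π F K)} (he : IsLieTrivialization I β e) {x₀ : M} (hx : x₀ ∈ e.baseSet)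
    (s : ∀ x, K x) :
    ContMDiffAt I (I.prod 𝓘(ℝ, F)) ∞ (fun x => TotalSpace.mk' F x (s x)) x₀ ↔
      ContMDiffAt I 𝓘(ℝ, F) ∞ (fun x => (e ⟨x, s x⟩).2) x₀ := by
  constructor
  · intro h
    have h1 := (he.contMDiffOn.contMDiffAt (x := TotalSpace.mk' F x₀ (s x₀))
      (e.open_source.mem_nhds (e.mem_source.2 hx))).comp x₀ h
    exact h1.snd
  · intro h
    have h1 : ContMDiffAt I (I.prod 𝓘(ℝ, F)) ∞ (fun x => (x, (e ⟨x, s x⟩).2)) x₀ :=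
      contMDiffAt_id.prodMk h
    have h2 := (he.contMDiffOn_symm.contMDiffAt (x := (x₀, (e ⟨x₀, s x₀⟩).2))
      (e.open_target.mem_nhds (e.mem_target.2 hx))).comp x₀ h1
    refine h2.congr_of_eventuallyEq ?_
    filter_upwards [e.open_baseSet.mem_nhds hx] with x hx'
    have := e.symm_apply_mk_proj (x := ⟨x, s x⟩) (e.mem_source.2 hx')
    exact this.symm

variable [VectorBundle ℝ F K] [ContMDiffVectorBundle ∞ F K I] [IsManifold I ∞ M]
  [LieAlgebraBundle I F K]

theorem contMDiff_lie {s t : ∀ x, K x}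
    (hs : ContMDiff I (I.prod 𝓘(ℝ, F)) ∞ (fun x => TotalSpace.mk' F x (s x)))
    (ht : ContMDiff I (I.prod 𝓘(ℝ, F)) ∞ (fun x => TotalSpace.mk' F x (t x))) :
    ContMDiff I (I.prod 𝓘(ℝ, F)) ∞ (fun x => TotalSpace.mk' F x (⁅s x, t x⁆ : K x)) := by
  intro x₀
  obtain ⟨e, he, hx⟩ := LieAlgebraBundle.exists_trivialization (I := I) (F := F) (K := K) x₀
  rw [he.contMDiffAt_section_iff hx]
  have h1 := (he.contMDiffAt_section_iff hx s).1 (hs x₀)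
  have h2 := (he.contMDiffAt_section_iff hx t).1 (ht x₀)
  have h3 : ContMDiffAt I 𝓘(ℝ, F) ∞
      (fun x => LieAlgebraBundle.modelBracket I K (e ⟨x, s x⟩).2 (e ⟨x, t x⟩).2) x₀ :=
    ((contMDiffAt_const (c := LieAlgebraBundle.modelBracket I K)).clm_apply h1).clm_apply h2
  refine h3.congr_of_eventuallyEq ?_
  filter_upwards [e.open_baseSet.mem_nhds hx] with x hx'
  exact he.map_lie x hx' _ _

/-- The bracket of sections of a Lie algebra bundle, defined pointwise. -/
instance sectionLieRing : LieRing Cₛ^∞⟮I; F, K⟯ where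
  bracket s t := ⟨fun x => ⁅s x, t x⁆, contMDiff_lie s.contMDiff t.contMDiff⟩
  add_lie s t u := by ext x; exact add_lie (s x) (t x) (u x)
  lie_add s t u := by ext x; exact lie_add (s x) (t x) (u x)
  lie_self s := by ext x; exact lie_self (s x)
  leibniz_lie s t u := by ext x; exact leibniz_lie (s x) (t x) (u x)

/-- The bracket of sections of a Lie algebra bundle is bilinear over the smooth functions. -/
instance sectionLieAlgebra : LieAlgebra C^∞⟮I, M; ℝ⟯ Cₛ^∞⟮I; F, K⟯ where
  lie_smul f s t := by ext x; exact lie_smul (f x) (s x) (t x)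


variable (I F K)

/-- The sections of `CDO[K]`, as a submodule: pairs of an `ℝ`-linear operator `D` on the sections of
`K` and a vector field `δ` (as a derivation of the smooth functions), such that
`D (f V) = f D V + δ(f) V` and `D` is a derivation of the bracket. -/
def cdoSubmodule : Submodule C^∞⟮I, M; ℝ⟯
    (Module.End ℝ Cₛ^∞⟮I; F, K⟯ × Derivation ℝ C^∞⟮I, M; ℝ⟯ C^∞⟮I, M; ℝ⟯) where
  carrier := {D | (∀ (f : C^∞⟮I, M; ℝ⟯) (V : Cₛ^∞⟮I; F, K⟯),
      D.1 (f • V) = f • D.1 V + D.2 f • V) ∧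
    ∀ V W : Cₛ^∞⟮I; F, K⟯, D.1 ⁅V, W⁆ = ⁅D.1 V, W⁆ + ⁅V, D.1 W⁆}
  zero_mem' := by simp
  add_mem' := by
    rintro D D' ⟨h1, h2⟩ ⟨h1', h2'⟩
    refine ⟨fun f V => ?_, fun V W => ?_⟩
    · simp only [Prod.fst_add, Prod.snd_add, LinearMap.add_apply, Derivation.add_apply, h1, h1']
      module
    · simp only [Prod.fst_add, LinearMap.add_apply, h2, h2', add_lie, lie_add]
      abel
  smul_mem' := by
    rintro g D ⟨h1, h2⟩
    refine ⟨fun f V => ?_, fun V W => ?_⟩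
    · simp only [Prod.smul_fst, Prod.smul_snd, LinearMap.smul_apply, Derivation.smul_apply, h1,
        smul_eq_mul]
      module
    · simp only [Prod.smul_fst, LinearMap.smul_apply, h2, smul_add, smul_lie, lie_smul]

/-- The module of sections of `CDO[K]`. -/
def CDO : Type _ := cdoSubmodule I F K

instance : AddCommGroup (CDO I F K) := inferInstanceAs (AddCommGroup (cdoSubmodule I F K))

instance : Module C^∞⟮I, M; ℝ⟯ (CDO I F K) :=
  inferInstanceAs (Module C^∞⟮I, M; ℝ⟯ (cdoSubmodule I F K))

variable {I F K}

/-- The operator on sections of `K` underlying a section of `CDO[K]`. -/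
def CDO.op (D : CDO I F K) : Cₛ^∞⟮I; F, K⟯ →ₗ[ℝ] Cₛ^∞⟮I; F, K⟯ := D.1.1

variable (I F K) in
/-- The anchor of `CDO[K]`: the vector field underlying an operator. -/
def CDO.symbol : CDO I F K →ₗ[C^∞⟮I, M; ℝ⟯] Derivation ℝ C^∞⟮I, M; ℝ⟯ C^∞⟮I, M; ℝ⟯ where
  toFun D := D.1.2
  map_add' _ _ := rfl
  map_smul' _ _ := rfl

theorem CDO.ext {D D' : CDO I F K} (h : ∀ V, D.op V = D'.op V)
    (h' : CDO.symbol I F K D = CDO.symbol I F K D') : D = D' :=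
  Subtype.ext (Prod.ext (LinearMap.ext h) h')

theorem CDO.op_smul (D : CDO I F K) (f : C^∞⟮I, M; ℝ⟯) (V : Cₛ^∞⟮I; F, K⟯) :
    D.op (f • V) = f • D.op V + CDO.symbol I F K D f • V := D.2.1 f V

theorem CDO.op_lie (D : CDO I F K) (V W : Cₛ^∞⟮I; F, K⟯) :
    D.op ⁅V, W⁆ = ⁅D.op V, W⁆ + ⁅V, D.op W⁆ := D.2.2 V W

/-- The commutator bracket of `CDO[K]`. -/
instance : Bracket (CDO I F K) (CDO I F K) where
  bracket D D' := ⟨(D.op ∘ₗ D'.op - D'.op ∘ₗ D.op, ⁅CDO.symbol I F K D, CDO.symbol I F K D'⁆), by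
    refine ⟨fun f V => ?_, fun V W => ?_⟩
    · simp only [LinearMap.sub_apply, LinearMap.comp_apply, CDO.op_smul, map_add,
        Derivation.commutator_apply]
      module
    · simp only [LinearMap.sub_apply, LinearMap.comp_apply, CDO.op_lie, map_add, sub_lie, lie_sub]
      abel⟩

theorem CDO.lie_op (D D' : CDO I F K) (V : Cₛ^∞⟮I; F, K⟯) :
    (⁅D, D'⁆ : CDO I F K).op V = D.op (D'.op V) - D'.op (D.op V) := rfl

theorem CDO.symbol_lie (D D' : CDO I F K) :
    CDO.symbol I F K ⁅D, D'⁆ = ⁅CDO.symbol I F K D, CDO.symbol I F K D'⁆ := rfl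

variable (I F K) in
/-- The adjoint action of the sections of `K` on the sections of `K`. -/
def innerCDO : Cₛ^∞⟮I; F, K⟯ →ₗ[C^∞⟮I, M; ℝ⟯] CDO I F K where
  toFun V := ⟨({ toFun := fun W => ⁅V, W⁆
                 map_add' := fun W W' => lie_add V W W'
                 map_smul' := fun c W => by ext x; exact lie_smul c (V x) (W x) }, 0), by
    refine ⟨fun f W => ?_, fun W W' => ?_⟩
    · simp
    · exact leibniz_lie V W W'⟩
  map_add' V V' := CDO.ext (fun W => add_lie V V' W) (add_zero 0).symm
  map_smul' f V := CDO.ext (fun W => smul_lie f V W) (smul_zero f).symm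

theorem symbol_innerCDO (V : Cₛ^∞⟮I; F, K⟯) : CDO.symbol I F K (innerCDO I F K V) = 0 := rfl

variable (I F K) in
/-- The module of sections of `OutDO[K] = CDO[K] / ad(K)`. -/
abbrev OutDO := CDO I F K ⧸ LinearMap.range (innerCDO I F K)

theorem lie_innerCDO (D : CDO I F K) (V : Cₛ^∞⟮I; F, K⟯) :
    ⁅D, innerCDO I F K V⁆ = innerCDO I F K (D.op V) := by
  refine CDO.ext (fun W => ?_) (Derivation.ext fun f => ?_)
  swap
  · rw [CDO.symbol_lie, Derivation.commutator_apply]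
    simp [symbol_innerCDO]
  change D.op ⁅V, W⁆ - ⁅V, D.op W⁆ = ⁅D.op V, W⁆
  rw [D.op_lie]
  abel

theorem innerCDO_lie (D : CDO I F K) (V : Cₛ^∞⟮I; F, K⟯) :
    ⁅innerCDO I F K V, D⁆ = -innerCDO I F K (D.op V) := by
  rw [← lie_innerCDO]
  refine CDO.ext (fun W => (neg_sub _ _).symm) (Derivation.ext fun f => ?_)
  simp only [map_neg, CDO.symbol_lie, Derivation.commutator_apply, Derivation.neg_apply, neg_sub]

theorem lie_sub_lie_mem (D₁ D₂ D₁' D₂' : CDO I F K)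
    (h : D₁ - D₂ ∈ LinearMap.range (innerCDO I F K))
    (h' : D₁' - D₂' ∈ LinearMap.range (innerCDO I F K)) :
    ⁅D₁, D₁'⁆ - ⁅D₂, D₂'⁆ ∈ LinearMap.range (innerCDO I F K) := by
  obtain ⟨V, hV⟩ := h
  obtain ⟨V', hV'⟩ := h'
  have key : ⁅D₁, D₁'⁆ - ⁅D₂, D₂'⁆ = ⁅D₁ - D₂, D₁'⁆ + ⁅D₂, D₁' - D₂'⁆ := by
    refine CDO.ext (fun W => ?_) ?_
    · change D₁.op (D₁'.op W) - D₁'.op (D₁.op W) - (D₂.op (D₂'.op W) - D₂'.op (D₂.op W)) =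
        ((D₁.op (D₁'.op W) - D₂.op (D₁'.op W)) - D₁'.op (D₁.op W - D₂.op W)) +
        (D₂.op (D₁'.op W - D₂'.op W) - (D₁'.op (D₂.op W) - D₂'.op (D₂.op W)))
      simp only [map_sub]
      abel
    · refine Derivation.ext fun f => ?_
      simp only [map_sub, map_add, CDO.symbol_lie, Derivation.commutator_apply,
        Derivation.sub_apply, Derivation.add_apply]
      abel
  rw [key, ← hV, ← hV', lie_innerCDO, innerCDO_lie]
  exact Submodule.add_mem _ (Submodule.neg_mem _ ⟨_, rfl⟩) ⟨_, rfl⟩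

/-- The bracket of `OutDO[K]` induced from the one of `CDO[K]`. -/
instance : Bracket (OutDO I F K) (OutDO I F K) where
  bracket := Quotient.map₂ (fun D D' => ⁅D, D'⁆) (by
    intro D₁ D₂ h D₁' D₂' h'
    exact (Submodule.quotientRel_def _).2 (lie_sub_lie_mem _ _ _ _
      ((Submodule.quotientRel_def _).1 h) ((Submodule.quotientRel_def _).1 h')))

theorem OutDO.mk_lie (D D' : CDO I F K) :
    ⁅(Submodule.Quotient.mk D : OutDO I F K), (Submodule.Quotient.mk D' : OutDO I F K)⁆ =
      Submodule.Quotient.mk ⁅D, D'⁆ := rfl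

variable (I F K) in
/-- The anchor of `OutDO[K]`, induced from the one of `CDO[K]`. -/
def OutDO.symbol : OutDO I F K →ₗ[C^∞⟮I, M; ℝ⟯] Derivation ℝ C^∞⟮I, M; ℝ⟯ C^∞⟮I, M; ℝ⟯ :=
  Submodule.liftQ _ (CDO.symbol I F K) (by rintro _ ⟨V, rfl⟩; rfl)


end Bundle

section Fibre

variable {M : Type*} (K : M → Type*) [∀ x, LieRing (K x)] [∀ x, LieAlgebra ℝ (K x)]

/-- The adjoint representation of the fibre of `K` at `x`. -/
def fibreAd (x : M) : K x →ₗ[ℝ] Module.End ℝ (K x) :=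
  LinearMap.mk₂ ℝ (fun v w => ⁅v, w⁆) add_lie smul_lie lie_add (fun c v w => lie_smul c v w)

/-- The fibre at `x` of the bundle `ad(K)`: the image of `ad : K x → End (K x)`. -/
def AdFibre (x : M) : Type _ := LinearMap.range (fibreAd K x)

instance (x : M) : AddCommGroup (AdFibre K x) :=
  inferInstanceAs (AddCommGroup (LinearMap.range (fibreAd K x)))

instance (x : M) : Module ℝ (AdFibre K x) :=
  inferInstanceAs (Module ℝ (LinearMap.range (fibreAd K x)))

instance (x : M) : TopologicalSpace (AdFibre K x) := moduleTopology ℝ (AdFibre K x)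

instance (x : M) : IsModuleTopology ℝ (AdFibre K x) := ⟨rfl⟩

variable {K}

/-- The endomorphism of `K x` underlying an element of the fibre of `ad(K)`. -/
def AdFibre.toEnd (x : M) : AdFibre K x →ₗ[ℝ] Module.End ℝ (K x) :=
  (LinearMap.range (fibreAd K x)).subtype

/-- The map `ad : K x → ad(K) x`. -/
def AdFibre.ofFibre (x : M) : K x →ₗ[ℝ] AdFibre K x := (fibreAd K x).rangeRestrict

theorem AdFibre.toEnd_ofFibre (x : M) (v w : K x) :
    AdFibre.toEnd x (AdFibre.ofFibre x v) w = ⁅v, w⁆ := rfl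

theorem AdFibre.toEnd_injective (x : M) : Function.Injective (AdFibre.toEnd (K := K) x) :=
  Subtype.val_injective

theorem AdFibre.ofFibre_surjective (x : M) : Function.Surjective (AdFibre.ofFibre (K := K) x) :=
  (fibreAd K x).surjective_rangeRestrict

end Fibre

section AdBundle

variable {E : Type*} [NormedAddCommGroup E] [NormedSpace ℝ E] {H : Type*} [TopologicalSpace H]
  (I : ModelWithCorners ℝ E H) {M : Type*} [TopologicalSpace M] [ChartedSpace H M]
  (F : Type*) [NormedAddCommGroup F] [NormedSpace ℝ F] (K : M → Type*)
  [TopologicalSpace (TotalSpace F K)] [∀ x, TopologicalSpace (K x)] [FiberBundle F K]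
  [∀ x, LieRing (K x)] [∀ x, LieAlgebra ℝ (K x)]

variable {I F K}

namespace IsLieTrivialization

variable {e e' : Trivialization F (π F K)} {β : F →L[ℝ] F →L[ℝ] F}

/-- The isomorphism of fibres given by a trivialization, extended by zero. -/
def fibreMap (he : IsLieTrivialization I β e) (x : M) : K x →ₗ[ℝ] F :=
  haveI := he.isLinear
  e.linearMapAt ℝ x

/-- The inverse isomorphism of fibres given by a trivialization, extended by zero. -/
def fibreSymm (he : IsLieTrivialization I β e) (x : M) : F →ₗ[ℝ] K x :=
  haveI := he.isLinear
  e.symmₗ ℝ x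

theorem fibreMap_apply (he : IsLieTrivialization I β e) {x : M} (hx : x ∈ e.baseSet) (v : K x) :
    he.fibreMap x v = (e ⟨x, v⟩).2 := by
  have := he.isLinear
  exact congrFun (e.coe_linearMapAt_of_mem hx) v

theorem fibreMap_fibreSymm (he : IsLieTrivialization I β e) {x : M} (hx : x ∈ e.baseSet) (v : F) :
    he.fibreMap x (he.fibreSymm x v) = v := by
  have := he.isLinear
  exact e.linearMapAt_symmₗ hx v

theorem fibreSymm_fibreMap (he : IsLieTrivialization I β e) {x : M} (hx : x ∈ e.baseSet)
    (v : K x) : he.fibreSymm x (he.fibreMap x v) = v := by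
  have := he.isLinear
  exact e.symmₗ_linearMapAt hx v

theorem fibreMap_lie (he : IsLieTrivialization I β e) {x : M} (hx : x ∈ e.baseSet) (v w : K x) :
    he.fibreMap x ⁅v, w⁆ = β (he.fibreMap x v) (he.fibreMap x w) := by
  simp only [he.fibreMap_apply hx, he.map_lie x hx]

theorem fibreSymm_lie (he : IsLieTrivialization I β e) {x : M} (hx : x ∈ e.baseSet) (v w : F) :
    he.fibreSymm x (β v w) = ⁅he.fibreSymm x v, he.fibreSymm x w⁆ := by
  rw [← he.fibreSymm_fibreMap hx ⁅he.fibreSymm x v, he.fibreSymm x w⁆, he.fibreMap_lie hx,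
    he.fibreMap_fibreSymm hx, he.fibreMap_fibreSymm hx]

/-- The change of Lie trivializations is smooth. -/
theorem exists_coordChange [FiniteDimensional ℝ F] (he : IsLieTrivialization I β e)
    (he' : IsLieTrivialization I β e') :
    ∃ f : M → F →L[ℝ] F, ContMDiffOn I 𝓘(ℝ, F →L[ℝ] F) ∞ f (e.baseSet ∩ e'.baseSet) ∧
      ∀ x ∈ e.baseSet ∩ e'.baseSet, ∀ v, f x v = he'.fibreMap x (he.fibreSymm x v) := by
  let b := Module.finBasis ℝ F
  let c : M → F → F := fun x v => he'.fibreMap x (he.fibreSymm x v)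
  refine ⟨fun x => ∑ i, ((b.coord i).toContinuousLinearMap).smulRight (c x (b i)), ?_, ?_⟩
  · refine contMDiffOn_finsetSum fun i _ x hx => ContMDiffAt.contMDiffWithinAt ?_
    have hs : ContMDiffAt I (I.prod 𝓘(ℝ, F)) ∞
        (fun y => TotalSpace.mk' F y (he.fibreSymm y (b i))) x := by
      rw [he.contMDiffAt_section_iff hx.1]
      refine (contMDiffAt_const (c := b i)).congr_of_eventuallyEq ?_
      filter_upwards [e.open_baseSet.mem_nhds hx.1] with y hy
      rw [← he.fibreMap_apply hy, he.fibreMap_fibreSymm hy]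
    rw [he'.contMDiffAt_section_iff hx.2] at hs
    have hc : ContMDiffAt I 𝓘(ℝ, F) ∞ (fun y => c y (b i)) x := by
      refine hs.congr_of_eventuallyEq ?_
      filter_upwards [e'.open_baseSet.mem_nhds hx.2] with y hy
      exact he'.fibreMap_apply hy _
    exact (ContinuousLinearMap.smulRightL ℝ F F
      ((b.coord i).toContinuousLinearMap)).contMDiff.contMDiffAt.comp x hc
  · intro x hx v
    have h : c x v = ∑ i, b.repr v i • c x (b i) := by
      conv_lhs => rw [← b.sum_repr v]
      simp only [c, map_sum, map_smul]
    simpa using h.symm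

end IsLieTrivialization

variable (I F K) [LieAlgebraBundle I F K]

/-- The typical fibre of `ad(K)`: the image of `ad : F → End F` for the model bracket. -/
def AdModel : Type _ :=
  LinearMap.range (LieAlgebraBundle.modelBracket I K : F →L[ℝ] F →L[ℝ] F).toLinearMap

instance : NormedAddCommGroup (AdModel I F K) := inferInstanceAs (NormedAddCommGroup
  (LinearMap.range (LieAlgebraBundle.modelBracket I K : F →L[ℝ] F →L[ℝ] F).toLinearMap))

instance : NormedSpace ℝ (AdModel I F K) := inferInstanceAs (NormedSpace ℝ
  (LinearMap.range (LieAlgebraBundle.modelBracket I K : F →L[ℝ] F →L[ℝ] F).toLinearMap))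

instance [FiniteDimensional ℝ F] : FiniteDimensional ℝ (AdModel I F K) :=
  inferInstanceAs (FiniteDimensional ℝ
    (LinearMap.range (LieAlgebraBundle.modelBracket I K : F →L[ℝ] F →L[ℝ] F).toLinearMap))

/-- The map `ad` of the typical fibre. -/
def AdModel.ofModel : F →L[ℝ] AdModel I F K :=
  (LieAlgebraBundle.modelBracket I K : F →L[ℝ] F →L[ℝ] F).codRestrict _
    (fun v => LinearMap.mem_range_self _ v)

/-- The endomorphism underlying an element of the typical fibre of `ad(K)`. -/
def AdModel.toEnd : AdModel I F K →L[ℝ] (F →L[ℝ] F) := Submodule.subtypeL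
  (LinearMap.range (LieAlgebraBundle.modelBracket I K : F →L[ℝ] F →L[ℝ] F).toLinearMap)

theorem AdModel.ofModel_surjective : Function.Surjective (AdModel.ofModel I F K) := by
  rintro ⟨_, v, rfl⟩
  exact ⟨v, rfl⟩

theorem AdModel.toEnd_injective : Function.Injective (AdModel.toEnd I F K) :=
  Subtype.val_injective

theorem AdModel.toEnd_ofModel (v : F) :
    AdModel.toEnd I F K (AdModel.ofModel I F K v) = LieAlgebraBundle.modelBracket I K v := rfl


variable {I F K}

namespace IsLieTrivialization

variable [FiniteDimensional ℝ F] {e e' : Trivialization F (π F K)}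

/-- The map `D ↦ e ∘ D ∘ e⁻¹` from a fibre of `ad(K)` to the typical fibre, extended by zero. -/
def adMap (he : IsLieTrivialization I (LieAlgebraBundle.modelBracket I K) e) (x : M) :
    AdFibre K x →ₗ[ℝ] AdModel I F K where
  toFun D := ⟨LinearMap.toContinuousLinearMap
      (he.fibreMap x ∘ₗ AdFibre.toEnd x D ∘ₗ he.fibreSymm x), by
    by_cases hx : x ∈ e.baseSet
    · obtain ⟨v, rfl⟩ := AdFibre.ofFibre_surjective x D
      refine ⟨he.fibreMap x v, ?_⟩
      ext w
      simp [AdFibre.toEnd_ofFibre, he.fibreMap_lie hx, he.fibreMap_fibreSymm hx]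
    · have : he.fibreMap x = 0 := by
        have := he.isLinear
        exact e.linearMapAt_def_of_notMem hx
      rw [this, LinearMap.zero_comp, map_zero]
      exact zero_mem _⟩
  map_add' D D' := by
    apply Subtype.ext
    ext w
    exact (congrArg (he.fibreMap x) (by simp)).trans (map_add (he.fibreMap x) _ _)
  map_smul' c D := by
    apply Subtype.ext
    ext w
    exact (congrArg (he.fibreMap x) (by simp)).trans (map_smul (he.fibreMap x) c _)

/-- The map `T ↦ e⁻¹ ∘ T ∘ e` from the typical fibre to a fibre of `ad(K)`, extended by zero. -/
def adSymm (he : IsLieTrivialization I (LieAlgebraBundle.modelBracket I K) e) (x : M) :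
    AdModel I F K →ₗ[ℝ] AdFibre K x where
  toFun T := ⟨he.fibreSymm x ∘ₗ (AdModel.toEnd I F K T).toLinearMap ∘ₗ he.fibreMap x, by
    by_cases hx : x ∈ e.baseSet
    · obtain ⟨v, rfl⟩ := AdModel.ofModel_surjective I F K T
      refine ⟨he.fibreSymm x v, ?_⟩
      ext w
      simp only [AdModel.toEnd_ofModel, LinearMap.comp_apply, ContinuousLinearMap.coe_coe,
        he.fibreSymm_lie hx, he.fibreSymm_fibreMap hx]
      rfl
    · have : he.fibreMap x = 0 := by
        have := he.isLinear
        exact e.linearMapAt_def_of_notMem hx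
      rw [this, LinearMap.comp_zero, LinearMap.comp_zero]
      exact zero_mem _⟩
  map_add' D D' := by
    apply Subtype.ext
    ext w
    exact (congrArg (he.fibreSymm x) (by simp)).trans (map_add (he.fibreSymm x) _ _)
  map_smul' c D := by
    apply Subtype.ext
    ext w
    exact (congrArg (he.fibreSymm x) (by simp)).trans (map_smul (he.fibreSymm x) c _)

theorem adMap_ofFibre (he : IsLieTrivialization I (LieAlgebraBundle.modelBracket I K) e) {x : M}
    (hx : x ∈ e.baseSet) (v : K x) :
    he.adMap x (AdFibre.ofFibre x v) = AdModel.ofModel I F K (he.fibreMap x v) := by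
  apply AdModel.toEnd_injective
  ext w
  change he.fibreMap x ⁅v, he.fibreSymm x w⁆ = LieAlgebraBundle.modelBracket I K _ w
  rw [he.fibreMap_lie hx, he.fibreMap_fibreSymm hx]

theorem adSymm_ofModel (he : IsLieTrivialization I (LieAlgebraBundle.modelBracket I K) e) {x : M}
    (hx : x ∈ e.baseSet) (v : F) :
    he.adSymm x (AdModel.ofModel I F K v) = AdFibre.ofFibre x (he.fibreSymm x v) := by
  apply AdFibre.toEnd_injective
  ext w
  change he.fibreSymm x (LieAlgebraBundle.modelBracket I K v (he.fibreMap x w)) = ⁅_, w⁆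
  rw [he.fibreSymm_lie hx, he.fibreSymm_fibreMap hx]

theorem adSymm_adMap (he : IsLieTrivialization I (LieAlgebraBundle.modelBracket I K) e) {x : M}
    (hx : x ∈ e.baseSet) (D : AdFibre K x) : he.adSymm x (he.adMap x D) = D := by
  obtain ⟨v, rfl⟩ := AdFibre.ofFibre_surjective x D
  rw [he.adMap_ofFibre hx, he.adSymm_ofModel hx, he.fibreSymm_fibreMap hx]

theorem adMap_adSymm (he : IsLieTrivialization I (LieAlgebraBundle.modelBracket I K) e) {x : M}
    (hx : x ∈ e.baseSet) (T : AdModel I F K) : he.adMap x (he.adSymm x T) = T := by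
  obtain ⟨v, rfl⟩ := AdModel.ofModel_surjective I F K T
  rw [he.adSymm_ofModel hx, he.adMap_ofFibre hx, he.fibreMap_fibreSymm hx]

/-- The local trivialization of `ad(K)` induced by a local trivialization of `K`. -/
def adPretrivialization (he : IsLieTrivialization I (LieAlgebraBundle.modelBracket I K) e) :
    Pretrivialization (AdModel I F K) (π (AdModel I F K) (AdFibre K)) where
  toFun p := (p.1, he.adMap p.1 p.2)
  invFun p := ⟨p.1, he.adSymm p.1 p.2⟩
  source := TotalSpace.proj ⁻¹' e.baseSet
  target := e.baseSet ×ˢ univ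
  map_source' := fun ⟨_, _⟩ h => ⟨h, mem_univ _⟩
  map_target' := fun ⟨_, _⟩ h => h.1
  left_inv' := fun ⟨x, D⟩ hx => by
    simp only [TotalSpace.mk_inj]
    exact he.adSymm_adMap hx D
  right_inv' := fun ⟨x, T⟩ hx => by
    simp only [Prod.mk_right_inj]
    exact he.adMap_adSymm hx.1 T
  open_target := e.open_baseSet.prod isOpen_univ
  baseSet := e.baseSet
  open_baseSet := e.open_baseSet
  source_eq := rfl
  target_eq := rfl
  proj_toFun _ _ := rfl

theorem adPretrivialization_isLinear
    (he : IsLieTrivialization I (LieAlgebraBundle.modelBracket I K) e) :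
    he.adPretrivialization.IsLinear ℝ where
  linear x _ := ⟨map_add (he.adMap x), map_smul (he.adMap x)⟩

theorem adPretrivialization_symm
    (he : IsLieTrivialization I (LieAlgebraBundle.modelBracket I K) e) {x : M}
    (hx : x ∈ e.baseSet) (T : AdModel I F K) :
    he.adPretrivialization.symm x T = he.adSymm x T := by
  rw [Pretrivialization.symm_apply _ hx]
  rfl

theorem exists_adCoordChange
    (he : IsLieTrivialization I (LieAlgebraBundle.modelBracket I K) e)
    (he' : IsLieTrivialization I (LieAlgebraBundle.modelBracket I K) e') :
    ∃ f : M → AdModel I F K →L[ℝ] AdModel I F K,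
      ContMDiffOn I 𝓘(ℝ, AdModel I F K →L[ℝ] AdModel I F K) ∞ f (e.baseSet ∩ e'.baseSet) ∧
      ∀ x ∈ e.baseSet ∩ e'.baseSet, ∀ T,
        f x T = (he'.adPretrivialization ⟨x, he.adPretrivialization.symm x T⟩).2 := by
  obtain ⟨f, hf, hf'⟩ := he.exists_coordChange he'
  obtain ⟨s, hs⟩ := (AdModel.ofModel I F K).toLinearMap.exists_rightInverse_of_surjective
    (LinearMap.range_eq_top.2 (AdModel.ofModel_surjective I F K))
  have hs' : ∀ T, AdModel.ofModel I F K (s T) = T := fun T => LinearMap.congr_fun hs T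
  refine ⟨fun x => (AdModel.ofModel I F K) ∘L (f x) ∘L (LinearMap.toContinuousLinearMap s),
    ?_, ?_⟩
  · exact contMDiffOn_const.clm_comp (hf.clm_comp contMDiffOn_const)
  · intro x hx T
    rw [he.adPretrivialization_symm hx.1]
    change AdModel.ofModel I F K (f x (s T)) = he'.adMap x (he.adSymm x T)
    conv_rhs => rw [← hs' T, he.adSymm_ofModel hx.1, he'.adMap_ofFibre hx.2]
    rw [hf' x hx]

theorem isInducing_adMap
    (he : IsLieTrivialization I (LieAlgebraBundle.modelBracket I K) e) {x : M}
    (hx : x ∈ e.baseSet) : Topology.IsInducing (he.adMap x) := by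
  have h1 : Continuous (he.adMap x) := IsModuleTopology.continuous_of_linearMap (R := ℝ) _
  have : IsModuleTopology ℝ (AdModel I F K) := isModuleTopologyOfFiniteDimensional
  have : ContinuousAdd (AdFibre K x) := IsModuleTopology.toContinuousAdd ℝ _
  have h2 : Continuous (he.adSymm x) := IsModuleTopology.continuous_of_linearMap (R := ℝ) _
  refine Topology.IsInducing.of_comp h1 h2 ?_
  rw [show he.adSymm x ∘ he.adMap x = id from funext (he.adSymm_adMap hx)]
  exact Topology.IsInducing.id

end IsLieTrivialization

variable [FiniteDimensional ℝ F]
variable (I F K) in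
/-- The bundle `ad(K)`, with the local trivializations induced by those of `K`. -/
def adPrebundle : VectorPrebundle ℝ (AdModel I F K) (AdFibre K) where
  pretrivializationAtlas := {p | ∃ (e : Trivialization F (π F K))
    (he : IsLieTrivialization I (LieAlgebraBundle.modelBracket I K) e), p = he.adPretrivialization}
  pretrivialization_linear' := by
    rintro _ ⟨e, he, rfl⟩
    exact he.adPretrivialization_isLinear
  pretrivializationAt x :=
    (LieAlgebraBundle.exists_trivialization (I := I) (F := F) (K := K)
      x).choose_spec.1.adPretrivialization
  mem_base_pretrivializationAt x :=
    (LieAlgebraBundle.exists_trivialization (I := I) (F := F) (K := K) x).choose_spec.2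
  pretrivialization_mem_atlas x := ⟨_,
    (LieAlgebraBundle.exists_trivialization (I := I) (F := F) (K := K) x).choose_spec.1, rfl⟩
  exists_coordChange := by
    rintro _ ⟨e, he, rfl⟩ _ ⟨e', he', rfl⟩
    obtain ⟨f, hf, hf'⟩ := he.exists_adCoordChange he'
    exact ⟨f, hf.continuousOn, hf'⟩
  totalSpaceMk_isInducing x := by
    have h := LieAlgebraBundle.exists_trivialization (I := I) (F := F) (K := K) x
    exact (isInducing_prodMkRight x).comp (h.choose_spec.1.isInducing_adMap h.choose_spec.2)

instance adPrebundle_isContMDiff : (adPrebundle I F K).IsContMDiff I ∞ where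
  exists_contMDiffCoordChange := by
    rintro _ ⟨e, he, rfl⟩ _ ⟨e', he', rfl⟩
    exact he.exists_adCoordChange he'

instance : TopologicalSpace (TotalSpace (AdModel I F K) (AdFibre K)) :=
  (adPrebundle I F K).totalSpaceTopology

instance : FiberBundle (AdModel I F K) (AdFibre K) := (adPrebundle I F K).toFiberBundle

instance : VectorBundle ℝ (AdModel I F K) (AdFibre K) := (adPrebundle I F K).toVectorBundle

instance : ContMDiffVectorBundle ∞ (AdModel I F K) (AdFibre K) I :=
  (adPrebundle I F K).contMDiffVectorBundle I

theorem IsLieTrivialization.contMDiffAt_adMap {e : Trivialization F (π F K)}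
    (he : IsLieTrivialization I (LieAlgebraBundle.modelBracket I K) e)
    (S : Cₛ^∞⟮I; AdModel I F K, AdFibre K⟯)
    {x : M} (hx : x ∈ e.baseSet) :
    ContMDiffAt I 𝓘(ℝ, AdModel I F K) ∞ (fun y => he.adMap y (S y)) x := by
  let t := (adPrebundle I F K).trivializationOfMemPretrivializationAtlas
    (e := he.adPretrivialization) ⟨e, he, rfl⟩
  have : MemTrivializationAtlas t := ⟨⟨_, ⟨e, he, rfl⟩, rfl⟩⟩
  exact (t.contMDiffAt_iff (f := fun y => TotalSpace.mk' (AdModel I F K) y (S y)) hx).1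
    (S.contMDiff x) |>.2

/-- The bundle map `ad : K → ad(K)`. -/
def VBMap.ad : VBMap I F K (AdModel I F K) (AdFibre K) where
  toFun := AdFibre.ofFibre
  contMDiff_toFun := by
    intro p
    obtain ⟨e, he, hx⟩ := LieAlgebraBundle.exists_trivialization (I := I) (F := F) (K := K) p.proj
    let t := (adPrebundle I F K).trivializationOfMemPretrivializationAtlas
      (e := he.adPretrivialization) ⟨e, he, rfl⟩
    have : MemTrivializationAtlas t := ⟨⟨_, ⟨e, he, rfl⟩, rfl⟩⟩
    have hp : p ∈ e.source := e.mem_source.2 hx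
    refine (t.contMDiffAt_iff hx).2 ⟨contMDiffAt_proj K, ?_⟩
    have h1 : ContMDiffAt (I.prod 𝓘(ℝ, F)) 𝓘(ℝ, F) ∞ (fun q => (e q).2) p :=
      (he.contMDiffOn.contMDiffAt (e.open_source.mem_nhds hp)).snd
    refine ((AdModel.ofModel I F K).contMDiff.contMDiffAt.comp p h1).congr_of_eventuallyEq ?_
    filter_upwards [e.open_source.mem_nhds hp] with q hq
    have hq' := e.mem_source.1 hq
    exact (he.adMap_ofFibre hq' q.2).trans (congrArg _ (he.fibreMap_apply hq' q.2))

end AdBundle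

section Sum

variable {E : Type*} [NormedAddCommGroup E] [NormedSpace ℝ E] {H : Type*} [TopologicalSpace H]
  {I : ModelWithCorners ℝ E H} {M : Type*} [TopologicalSpace M] [ChartedSpace H M]
  {F₁ : Type*} [NormedAddCommGroup F₁] [NormedSpace ℝ F₁] {A₁ : M → Type*}
  [TopologicalSpace (TotalSpace F₁ A₁)] [∀ x, TopologicalSpace (A₁ x)] [FiberBundle F₁ A₁]
  [∀ x, AddCommGroup (A₁ x)] [∀ x, Module ℝ (A₁ x)] [VectorBundle ℝ F₁ A₁]
  {F₂ : Type*} [NormedAddCommGroup F₂] [NormedSpace ℝ F₂] {A₂ : M → Type*}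
  [TopologicalSpace (TotalSpace F₂ A₂)] [∀ x, TopologicalSpace (A₂ x)] [FiberBundle F₂ A₂]
  [∀ x, AddCommGroup (A₂ x)] [∀ x, Module ℝ (A₂ x)] [VectorBundle ℝ F₂ A₂]
  {F₃ : Type*} [NormedAddCommGroup F₃] [NormedSpace ℝ F₃] {A₃ : M → Type*}
  [TopologicalSpace (TotalSpace F₃ A₃)] [∀ x, TopologicalSpace (A₃ x)] [FiberBundle F₃ A₃]
  [∀ x, AddCommGroup (A₃ x)] [∀ x, Module ℝ (A₃ x)]

/-- Composition of vector bundle morphisms. -/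
def VBMap.comp (ψ : VBMap I F₂ A₂ F₃ A₃) (φ : VBMap I F₁ A₁ F₂ A₂) : VBMap I F₁ A₁ F₃ A₃ where
  toFun x := ψ.toFun x ∘ₗ φ.toFun x
  contMDiff_toFun := ψ.contMDiff_toFun.comp φ.contMDiff_toFun

/-- The zero morphism of vector bundles. -/
def VBMap.zero : VBMap I F₁ A₁ F₂ A₂ where
  toFun _ := 0
  contMDiff_toFun := (contMDiff_zeroSection ℝ A₂).comp (contMDiff_proj A₁)

/-- The first projection of a direct sum of vector bundles. -/
def VBMap.fst : VBMap I (F₁ × F₂) (A₁ ×ᵇ A₂) F₁ A₁ where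
  toFun x := LinearMap.fst ℝ (A₁ x) (A₂ x)
  contMDiff_toFun p := by
    have h := (contMDiffAt_totalSpace.1 (contMDiffAt_id (I := I.prod 𝓘(ℝ, F₁ × F₂)) (n := ∞)
      (x := p))).2
    exact contMDiffAt_totalSpace.2 ⟨contMDiffAt_proj _,
      (ContinuousLinearMap.fst ℝ F₁ F₂).contMDiff.contMDiffAt.comp p h⟩

/-- The second projection of a direct sum of vector bundles. -/
def VBMap.snd : VBMap I (F₁ × F₂) (A₁ ×ᵇ A₂) F₂ A₂ where
  toFun x := LinearMap.snd ℝ (A₁ x) (A₂ x)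
  contMDiff_toFun p := by
    have h := (contMDiffAt_totalSpace.1 (contMDiffAt_id (I := I.prod 𝓘(ℝ, F₁ × F₂)) (n := ∞)
      (x := p))).2
    exact contMDiffAt_totalSpace.2 ⟨contMDiffAt_proj _,
      (ContinuousLinearMap.snd ℝ F₁ F₂).contMDiff.contMDiffAt.comp p h⟩

/-- The morphism to a direct sum of vector bundles with given components. -/
def VBMap.prod (φ : VBMap I F₁ A₁ F₂ A₂) (ψ : VBMap I F₁ A₁ F₃ A₃) :
    VBMap I F₁ A₁ (F₂ × F₃) (A₂ ×ᵇ A₃) where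
  toFun x := (φ.toFun x).prod (ψ.toFun x)
  contMDiff_toFun p := by
    have h := (contMDiffAt_totalSpace.1 (φ.contMDiff_toFun p)).2
    have h' := (contMDiffAt_totalSpace.1 (ψ.contMDiff_toFun p)).2
    exact contMDiffAt_totalSpace.2 ⟨contMDiffAt_proj _, h.prodMk_space h'⟩

/-- The section of a direct sum of vector bundles with given components. -/
def sectionProd (X : Cₛ^∞⟮I; F₁, A₁⟯) (Y : Cₛ^∞⟮I; F₂, A₂⟯) :
    Cₛ^∞⟮I; F₁ × F₂, A₁ ×ᵇ A₂⟯ where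
  toFun x := (X x, Y x)
  contMDiff_toFun p := by
    have h := (contMDiffAt_totalSpace.1 (X.contMDiff p)).2
    have h' := (contMDiffAt_totalSpace.1 (Y.contMDiff p)).2
    exact contMDiffAt_totalSpace.2 ⟨contMDiffAt_id, h.prodMk_space h'⟩

end Sum

section Coupling

variable {E : Type*} [NormedAddCommGroup E] [NormedSpace ℝ E] {H : Type*} [TopologicalSpace H]
  {I : ModelWithCorners ℝ E H} {M : Type*} [TopologicalSpace M] [ChartedSpace H M]
  {F : Type*} [NormedAddCommGroup F] [NormedSpace ℝ F] [FiniteDimensional ℝ F] {K : M → Type*}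
  [TopologicalSpace (TotalSpace F K)] [∀ x, TopologicalSpace (K x)] [FiberBundle F K]
  [∀ x, LieRing (K x)] [∀ x, LieAlgebra ℝ (K x)] [VectorBundle ℝ F K]
  [ContMDiffVectorBundle ∞ F K I] [IsManifold I ∞ M] [LieAlgebraBundle I F K]

/-- The action of a section of `ad(K)` on the sections of `K`, as a section of `CDO[K]`. -/
def adCDO : Cₛ^∞⟮I; AdModel I F K, AdFibre K⟯ →ₗ[C^∞⟮I, M; ℝ⟯] CDO I F K where
  toFun S := ⟨({ toFun := fun V => ⟨fun x => AdFibre.toEnd x (S x) (V x), by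
                   intro x₀
                   obtain ⟨e, he, hx⟩ :=
                     LieAlgebraBundle.exists_trivialization (I := I) (F := F) (K := K) x₀
                   rw [he.contMDiffAt_section_iff hx]
                   have h1 := he.contMDiffAt_adMap S hx
                   have h2 := (he.contMDiffAt_section_iff hx _).1 (V.contMDiff x₀)
                   have h3 := ((AdModel.toEnd I F K).contMDiff.contMDiffAt.comp x₀ h1).clm_apply h2
                   refine h3.congr_of_eventuallyEq ?_
                   filter_upwards [e.open_baseSet.mem_nhds hx] with x hx'
                   rw [← he.fibreMap_apply hx', ← he.fibreMap_apply hx']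
                   change _ = he.fibreMap x (AdFibre.toEnd x (S x) (he.fibreSymm x _))
                   rw [he.fibreSymm_fibreMap hx']⟩
                 map_add' := fun V W => by
                   ext x; exact map_add (AdFibre.toEnd x (S x)) (V x) (W x)
                 map_smul' := fun c V => by
                   ext x; exact map_smul (AdFibre.toEnd x (S x)) c (V x) }, 0), by
    refine ⟨fun f V => ?_, fun V W => ?_⟩
    · rw [Derivation.zero_apply, zero_smul, add_zero]
      ext x
      exact map_smul (AdFibre.toEnd x (S x)) (f x) (V x)
    · ext x
      obtain ⟨v, hv⟩ := AdFibre.ofFibre_surjective x (S x)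
      change AdFibre.toEnd x (S x) ⁅V x, W x⁆ =
        ⁅AdFibre.toEnd x (S x) (V x), W x⁆ + ⁅V x, AdFibre.toEnd x (S x) (W x)⁆
      rw [← hv]
      exact leibniz_lie v (V x) (W x)⟩
  map_add' S T := CDO.ext (fun V => rfl) (add_zero 0).symm
  map_smul' f S := CDO.ext (fun V => rfl) (smul_zero f).symm

variable (I F K) in
/-- A Lie algebra bundle as a Lie algebroid with zero anchor. -/
def LieAlgebraBundle.toLieAlgebroid : LieAlgebroid I F K where
  anchor := VBMap.zero
  bracket := LinearMap.mk₂ ℝ (fun V W => ⁅V, W⁆) add_lie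
    (fun c V W => by ext x; exact smul_lie c (V x) (W x)) lie_add
    (fun c V W => by ext x; exact lie_smul c (V x) (W x))
  bracket_self V := lie_self V
  jacobi U V W := leibniz_lie U V W
  bracket_smul V f W := by
    have h : (VBMap.zero : VBMap I F K E (TangentSpace I : M → Type _)).onSections V = 0 := rfl
    rw [h, map_zero, Derivation.zero_apply, zero_smul, add_zero]
    exact lie_smul f V W
  anchor_bracket V W := by
    have h : ∀ V, (VBMap.zero : VBMap I F K E (TangentSpace I : M → Type _)).onSections V = 0 :=
      fun _ => rfl
    rw [h, h, h, map_zero]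
    exact (lie_self _).symm

variable {FB : Type*} [NormedAddCommGroup FB] [NormedSpace ℝ FB] {B : M → Type*}
  [TopologicalSpace (TotalSpace FB B)] [∀ x, TopologicalSpace (B x)] [FiberBundle FB B]
  [∀ x, AddCommGroup (B x)] [∀ x, Module ℝ (B x)] [VectorBundle ℝ FB B]

variable (F K) in
/-- A coupling of the Lie algebroid `ℬ` with the Lie algebra bundle `K`: a morphism of Lie
algebroids `B → OutDO[K]`. Vector bundle morphisms over the identity with values in `OutDO[K]` or
`CDO[K]` are given by their action on sections, which is linear over the smooth functions. -/
@[ext]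
structure Coupling (ℬ : LieAlgebroid I FB B) where
  toLinearMap : Cₛ^∞⟮I; FB, B⟯ →ₗ[C^∞⟮I, M; ℝ⟯] OutDO I F K
  symbol_eq : ∀ X, OutDO.symbol I F K (toLinearMap X) = ℬ.anchorDerivation X
  map_bracket : ∀ X Y, toLinearMap (ℬ.bracket X Y) = ⁅toLinearMap X, toLinearMap Y⁆

/-- A vector bundle morphism `∇ : B → CDO[K]` is a Lie derivation law covering the coupling `Ξ` if
its composition with the projection `CDO[K] → OutDO[K]` is `Ξ`. -/
def Covers {ℬ : LieAlgebroid I FB B} (nabla : Cₛ^∞⟮I; FB, B⟯ →ₗ[C^∞⟮I, M; ℝ⟯] CDO I F K)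
    (Ξ : Coupling F K ℬ) : Prop :=
  ∀ X, (Submodule.Quotient.mk (nabla X) : OutDO I F K) = Ξ.toLinearMap X

/-- The curvature `∇_[X,Y] - [∇_X, ∇_Y]`. -/
def curvature (ℬ : LieAlgebroid I FB B)
    (nabla : Cₛ^∞⟮I; FB, B⟯ →ₗ[C^∞⟮I, M; ℝ⟯] CDO I F K) (X Y : Cₛ^∞⟮I; FB, B⟯) : CDO I F K :=
  nabla (ℬ.bracket X Y) - ⁅nabla X, nabla Y⁆

/-- The Lie algebroid structure `𝒜` on `B ⊕ ad(K)` has the anchor of `ℬ` on the first summand, and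
the bracket `[X ⊕ ad_V, Y ⊕ ad_W] = [X, Y] ⊕ (ad_{∇_X W} - ad_{∇_Y V} + ad_{[V, W]} - R_∇(X, Y))`,
where sections of `ad(K)` are compared through their action on sections of `K`. -/
structure IsTwistedSum (ℬ : LieAlgebroid I FB B)
    (nabla : Cₛ^∞⟮I; FB, B⟯ →ₗ[C^∞⟮I, M; ℝ⟯] CDO I F K)
    (𝒜 : LieAlgebroid I (FB × AdModel I F K) (B ×ᵇ AdFibre K)) : Prop where
  anchor_eq : ∀ x (v : B x × AdFibre K x), 𝒜.anchor.toFun x v = ℬ.anchor.toFun x v.1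
  fst_bracket : ∀ (X Y : Cₛ^∞⟮I; FB, B⟯) (V W : Cₛ^∞⟮I; F, K⟯),
    VBMap.fst.onSections (𝒜.bracket (sectionProd X (VBMap.ad.onSections V))
      (sectionProd Y (VBMap.ad.onSections W))) = ℬ.bracket X Y
  snd_bracket : ∀ (X Y : Cₛ^∞⟮I; FB, B⟯) (V W : Cₛ^∞⟮I; F, K⟯),
    adCDO (VBMap.snd.onSections (𝒜.bracket (sectionProd X (VBMap.ad.onSections V))
      (sectionProd Y (VBMap.ad.onSections W)))) =
    innerCDO I F K ((nabla X).op W) - innerCDO I F K ((nabla Y).op V) + innerCDO I F K ⁅V, W⁆ -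
      curvature ℬ nabla X Y

/-- The map `τ : K → B ⊕ ad(K)`, `τ(V) = 0 ⊕ ad_V`. -/
def sumTau : VBMap I F K (FB × AdModel I F K) (B ×ᵇ AdFibre K) :=
  VBMap.prod VBMap.zero VBMap.ad

/-- The map `ρ : B ⊕ ad(K) → CDO[K]`, `ρ(X ⊕ ad_V)(W) = ∇_X(W) + [V, W]`. -/
def sumRho (nabla : Cₛ^∞⟮I; FB, B⟯ →ₗ[C^∞⟮I, M; ℝ⟯] CDO I F K) :
    Cₛ^∞⟮I; FB × AdModel I F K, B ×ᵇ AdFibre K⟯ →ₗ[C^∞⟮I, M; ℝ⟯] CDO I F K :=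
  nabla ∘ₗ VBMap.fst.onSections + adCDO ∘ₗ VBMap.snd.onSections

variable {FA : Type*} [NormedAddCommGroup FA] [NormedSpace ℝ FA] {A : M → Type*}
  [TopologicalSpace (TotalSpace FA A)] [∀ x, TopologicalSpace (A x)] [FiberBundle FA A]
  [∀ x, AddCommGroup (A x)] [∀ x, Module ℝ (A x)] [VectorBundle ℝ FA A]

/-- A representation of the Lie algebroid `𝒜` in `K`: a morphism of Lie algebroids
`ρ : A → CDO[K]`, given by its action on sections. -/
structure IsRepresentation (𝒜 : LieAlgebroid I FA A)
    (ρ : Cₛ^∞⟮I; FA, A⟯ →ₗ[C^∞⟮I, M; ℝ⟯] CDO I F K) : Prop where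
  symbol_eq : ∀ X, CDO.symbol I F K (ρ X) = 𝒜.anchorDerivation X
  map_bracket : ∀ X Y, ρ (𝒜.bracket X Y) = ⁅ρ X, ρ Y⁆

/-- A crossed module of Lie algebroids `(K, τ, A, ρ)`. -/
structure IsCrossedModule (τ : VBMap I F K FA A) (𝒜 : LieAlgebroid I FA A)
    (ρ : Cₛ^∞⟮I; FA, A⟯ →ₗ[C^∞⟮I, M; ℝ⟯] CDO I F K) : Prop where
  transitive : 𝒜.IsTransitive
  tau_morphism : IsLieAlgebroidMorphism (LieAlgebraBundle.toLieAlgebroid I F K) 𝒜 τ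
  rho_representation : IsRepresentation 𝒜 ρ
  rho_tau : ∀ V W : Cₛ^∞⟮I; F, K⟯, (ρ (τ.onSections V)).op W = ⁅V, W⁆
  tau_rho : ∀ (X : Cₛ^∞⟮I; FA, A⟯) (V : Cₛ^∞⟮I; F, K⟯),
    τ.onSections ((ρ X).op V) = 𝒜.bracket X (τ.onSections V)

/-- The Lie algebroid `ℬ`, with the projection `proj : A → B`, is the quotient Lie algebroid of `𝒜`
by the image of `τ`. -/
structure IsCokernel (τ : VBMap I F K FA A) (𝒜 : LieAlgebroid I FA A) (ℬ : LieAlgebroid I FB B)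
    (proj : VBMap I FA A FB B) : Prop where
  morphism : IsLieAlgebroidMorphism 𝒜 ℬ proj
  surjective : ∀ x, Function.Surjective (proj.toFun x)
  ker_eq : ∀ x, LinearMap.ker (proj.toFun x) = LinearMap.range (τ.toFun x)

/-- A coupling crossed module of `ℬ` with `K`: a crossed module with cokernel `ℬ` and such that the
kernel of `τ` is the centre of `K`. -/
structure IsCouplingCrossedModule (τ : VBMap I F K FA A) (𝒜 : LieAlgebroid I FA A)
    (ρ : Cₛ^∞⟮I; FA, A⟯ →ₗ[C^∞⟮I, M; ℝ⟯] CDO I F K) (ℬ : LieAlgebroid I FB B)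
    (proj : VBMap I FA A FB B) : Prop extends IsCrossedModule τ 𝒜 ρ where
  cokernel : IsCokernel τ 𝒜 ℬ proj
  ker_tau : ∀ x, LinearMap.ker (τ.toFun x) = (LieAlgebra.center ℝ (K x)).toSubmodule

/-- The representation `ρ` descends along `proj : A → B` to the coupling `Ξ : B → OutDO[K]`. -/
def Induces {ℬ : LieAlgebroid I FB B} (ρ : Cₛ^∞⟮I; FA, A⟯ →ₗ[C^∞⟮I, M; ℝ⟯] CDO I F K)
    (proj : VBMap I FA A FB B) (Ξ : Coupling F K ℬ) : Prop :=
  ∀ X, Ξ.toLinearMap (proj.onSections X) = (Submodule.Quotient.mk (ρ X) : OutDO I F K)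

variable {FA' : Type*} [NormedAddCommGroup FA'] [NormedSpace ℝ FA'] {A' : M → Type*}
  [TopologicalSpace (TotalSpace FA' A')] [∀ x, TopologicalSpace (A' x)] [FiberBundle FA' A']
  [∀ x, AddCommGroup (A' x)] [∀ x, Module ℝ (A' x)] [VectorBundle ℝ FA' A']

/-- Equivalence of crossed modules with the same cokernel `B` and the same `K`: a morphism of Lie
algebroids `θ : A → A'` with `θ ∘ τ = τ'`, `proj' ∘ θ = proj` and `ρ' ∘ θ = ρ`. -/
def AreEquivalent (τ : VBMap I F K FA A) (𝒜 : LieAlgebroid I FA A)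
    (ρ : Cₛ^∞⟮I; FA, A⟯ →ₗ[C^∞⟮I, M; ℝ⟯] CDO I F K) (proj : VBMap I FA A FB B)
    (τ' : VBMap I F K FA' A') (𝒜' : LieAlgebroid I FA' A')
    (ρ' : Cₛ^∞⟮I; FA', A'⟯ →ₗ[C^∞⟮I, M; ℝ⟯] CDO I F K) (proj' : VBMap I FA' A' FB B) : Prop :=
  ∃ θ : VBMap I FA A FA' A', IsLieAlgebroidMorphism 𝒜 𝒜' θ ∧
    (∀ x v, θ.toFun x (τ.toFun x v) = τ'.toFun x v) ∧
    (∀ x v, proj'.toFun x (θ.toFun x v) = proj.toFun x v) ∧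
    ∀ X, ρ' (θ.onSections X) = ρ X

end Coupling

end

end Algd

open Algd

/-!
A coupling of `B` with `K` and a coupling crossed module of `B` with `K` determine each other because
the sections of a coupling crossed module are a fibre product. If `(K, τ, A, ρ)` is a coupling
crossed module inducing `Ξ`, then `X ↦ (proj X, ρ X)` identifies `ΓA` with the set of pairs `(X, D)`
in `ΓB × Γ CDO[K]` such that `Ξ X` is the class of `D`, and brackets with componentwise brackets
(`IsCouplingCrossedModule.jointly_injective`, `IsCouplingCrossedModule.exists_proj_eq_rho_eq`).
Hence two modules inducing the same coupling are isomorphic on sections, and an isomorphism of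
sections that is linear over the smooth functions comes from a bundle map.

Conversely, for a Lie derivation law `∇` covering `Ξ`, the map `(X, S) ↦ (X, ∇_X + S)` identifies the
sections of `B ⊕ ad(K)` with the same fibre product, and the bracket formula of the twisted sum
expresses exactly that brackets correspond (`isTwistedSum_iff`). Existence, uniqueness, the Jacobi
identity and the Leibniz rule are therefore inherited from `B` and `CDO[K]`, with no computation
involving the curvature beyond this translation.

The analytic input is that smooth sections behave well globally: the module `ΓB` acts like a
projective module (`exists_lift`), fibrewise surjective maps and exact sequences `A₁ → A₂ → A₃ → 0`
of bundles stay surjective and exact on sections (`VBMap.onSections_surjective`,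
`VBMap.exists_onSections_eq_of_exact`), and maps linear over the smooth functions are bundle maps
(`exists_onSections_eq`). All of these are proved with local frames cut off by bump functions
(`BumpFrame`) and sums weighted by a partition of unity (`lfSum`). The latter also make sense in
`CDO[K]` (`CDO.lfSum`), which is what produces Lie derivation laws.
-/

namespace Algd

noncomputable section

section Sections

variable {E : Type*} [NormedAddCommGroup E] [NormedSpace ℝ E]
  {H : Type*} [TopologicalSpace H] {I : ModelWithCorners ℝ E H}
  {M : Type*} [TopologicalSpace M] [ChartedSpace H M]
  {F : Type*} [NormedAddCommGroup F] [NormedSpace ℝ F] {A : M → Type*}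
  [TopologicalSpace (TotalSpace F A)] [∀ x, TopologicalSpace (A x)] [FiberBundle F A]
  [∀ x, AddCommGroup (A x)] [∀ x, Module ℝ (A x)] [VectorBundle ℝ F A]
  {F' : Type*} [NormedAddCommGroup F'] [NormedSpace ℝ F'] {A' : M → Type*}
  [TopologicalSpace (TotalSpace F' A')] [∀ x, TopologicalSpace (A' x)] [FiberBundle F' A']
  [∀ x, AddCommGroup (A' x)] [∀ x, Module ℝ (A' x)] [VectorBundle ℝ F' A']

/-! ### Locally finite sums of sections -/

theorem VBMap.ext {φ ψ : VBMap I F A F' A'} (h : ∀ x v, φ.toFun x v = ψ.toFun x v) : φ = ψ := by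
  obtain ⟨f, hf⟩ := φ
  obtain ⟨g, hg⟩ := ψ
  obtain rfl : f = g := funext fun x => LinearMap.ext (h x)
  rfl

theorem VBMap.onSections_apply (φ : VBMap I F A F' A') (s : Cₛ^∞⟮I; F, A⟯) (x : M) :
    φ.onSections s x = φ.toFun x (s x) := rfl

/-- Evaluation of sections at a point, as an additive map. -/
def evalHom (x : M) : Cₛ^∞⟮I; F, A⟯ →+ A x where
  toFun s := s x
  map_zero' := rfl
  map_add' _ _ := rfl

theorem sum_section_apply {ι : Type*} (t : Finset ι) (s : ι → Cₛ^∞⟮I; F, A⟯) (x : M) :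
    (∑ i ∈ t, s i) x = ∑ i ∈ t, s i x :=
  map_sum (evalHom x) s t

theorem finsum_smul_eq_sum {V : Type*} [AddCommGroup V] [Module ℝ V]
    (ρ : SmoothPartitionOfUnity M I M univ) (x : M) (v : M → V) :
    ∑ᶠ i, ρ i x • v i = ∑ i ∈ ρ.finsupport x, ρ i x • v i :=
  (ρ.sum_finsupport_smul_eq_finsum x fun i _ => v i).symm

/-- The sum `∑ ρ i • s i` of sections weighted by a smooth partition of unity. -/
def lfSum (ρ : SmoothPartitionOfUnity M I M univ) :
    (M → Cₛ^∞⟮I; F, A⟯) →ₗ[C^∞⟮I, M; ℝ⟯] Cₛ^∞⟮I; F, A⟯ where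
  toFun s := ⟨fun x => ∑ᶠ i, ρ i x • s i x,
    ContMDiff.finsum_section_of_locallyFinite
      (ρ.locallyFinite.subset fun i x hx h => hx (by simp [h]))
      fun i => (ρ i).contMDiff.smul_section (s i).contMDiff⟩
  map_add' s t := by
    ext x
    change ∑ᶠ i, ρ i x • (s i x + t i x) = ∑ᶠ i, ρ i x • s i x + ∑ᶠ i, ρ i x • t i x
    rw [finsum_smul_eq_sum ρ x fun i => s i x + t i x]
    simp only [finsum_smul_eq_sum, smul_add, Finset.sum_add_distrib]
  map_smul' f s := by
    ext x
    change ∑ᶠ i, ρ i x • (f x • s i x) = f x • ∑ᶠ i, ρ i x • s i x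
    simp only [finsum_smul_eq_sum, Finset.smul_sum, smul_comm (f x)]

theorem lfSum_apply (ρ : SmoothPartitionOfUnity M I M univ) (s : M → Cₛ^∞⟮I; F, A⟯) (x : M) :
    lfSum ρ s x = ∑ i ∈ ρ.finsupport x, ρ i x • s i x :=
  finsum_smul_eq_sum ρ x fun i => s i x

theorem VBMap.onSections_lfSum (φ : VBMap I F A F' A') (ρ : SmoothPartitionOfUnity M I M univ)
    (s : M → Cₛ^∞⟮I; F, A⟯) :
    φ.onSections (lfSum ρ s) = lfSum ρ fun i => φ.onSections (s i) := by
  ext x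
  simp only [VBMap.onSections_apply, lfSum_apply, map_sum, map_smul]

theorem sum_finsupport_smul_smul {V : Type*} [AddCommGroup V] [Module ℝ V]
    (ρ : SmoothPartitionOfUnity M I M univ) {χ : M → C^∞⟮I, M; ℝ⟯}
    (h : ∀ i x, ρ i x * χ i x = ρ i x) (x : M) (v : V) :
    ∑ i ∈ ρ.finsupport x, ρ i x • χ i x • v = v := by
  simp only [smul_smul, h]
  rw [← Finset.sum_smul, ρ.sum_finsupport x (mem_univ x), one_smul]

theorem lfSum_smul_const (ρ : SmoothPartitionOfUnity M I M univ) {χ : M → C^∞⟮I, M; ℝ⟯}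
    (h : ∀ i x, ρ i x * χ i x = ρ i x) (s : Cₛ^∞⟮I; F, A⟯) :
    lfSum ρ (fun i => χ i • s) = s := by
  ext x
  simp only [lfSum_apply, smul_section_apply]
  exact sum_finsupport_smul_smul ρ h x (s x)

variable [FiniteDimensional ℝ E] [IsManifold I ∞ M] [T2Space M]

open Filter Topology in
theorem exists_eventually_mul_eq_one (χ : C^∞⟮I, M; ℝ⟯) {x : M} (hx : χ x ≠ 0) :
    ∃ g : C^∞⟮I, M; ℝ⟯, ∀ᶠ y in 𝓝 x, (g * χ) y = 1 := by
  have hU : {y | χ y ≠ 0} ∈ 𝓝 x :=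
    (isOpen_ne_fun χ.contMDiff.continuous continuous_const).mem_nhds hx
  obtain ⟨f, hf, -⟩ := (SmoothBumpFunction.nhds_basis_support (I := I) hU).mem_iff.1 hU
  refine ⟨⟨fun y => f y * (χ y)⁻¹, contMDiff_of_tsupport fun y hy => ?_⟩, ?_⟩
  · exact f.contMDiffAt.mul
      ((χ.contMDiff y).inv₀ (hf (closure_mono (Function.support_mul_subset_left _ _) hy)))
  · filter_upwards [f.eventuallyEq_one, hU] with y hy hy'
    change f y * (χ y)⁻¹ * χ y = 1
    rw [hy, Pi.one_apply, one_mul, inv_mul_cancel₀ hy']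

variable [SigmaCompactSpace M]

open Filter Topology in
theorem exists_partitionOfUnity_mul_eq (χ : M → C^∞⟮I, M; ℝ⟯)
    (h : ∀ x, ∀ᶠ y in 𝓝 x, χ x y = 1) :
    ∃ ρ : SmoothPartitionOfUnity M I M univ, ∀ i x, ρ i x * χ i x = ρ i x := by
  choose U hU hUo hUx using fun x => eventually_nhds_iff.1 (h x)
  obtain ⟨ρ, hρ⟩ := SmoothPartitionOfUnity.exists_isSubordinate I isClosed_univ U hUo
    fun x _ => mem_iUnion.2 ⟨x, hUx x⟩
  refine ⟨ρ, fun i x => ?_⟩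
  by_cases hx : x ∈ tsupport (ρ i)
  · rw [hU i x (hρ i hx), mul_one]
  · rw [image_eq_zero_of_notMem_tsupport hx, zero_mul]

/-- A submodule of sections that is stable under locally finite sums is determined locally. -/
theorem mem_of_forall_exists_smul_mem (Q : Submodule C^∞⟮I, M; ℝ⟯ Cₛ^∞⟮I; F, A⟯)
    (hQ : ∀ (ρ : SmoothPartitionOfUnity M I M univ) (s : M → Cₛ^∞⟮I; F, A⟯),
      (∀ i, s i ∈ Q) → lfSum ρ s ∈ Q)
    (t : Cₛ^∞⟮I; F, A⟯) (h : ∀ x, ∃ χ : C^∞⟮I, M; ℝ⟯, χ x ≠ 0 ∧ χ • t ∈ Q) : t ∈ Q := by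
  choose χ hχ hχt using h
  choose g hg using fun x => exists_eventually_mul_eq_one (χ x) (hχ x)
  obtain ⟨ρ, hρ⟩ := exists_partitionOfUnity_mul_eq (fun x => g x * χ x) hg
  rw [← lfSum_smul_const ρ hρ t]
  refine hQ ρ _ fun i => ?_
  rw [mul_smul]
  exact Q.smul_mem _ (hχt i)

/-! ### Bump frames -/

variable (I F A) in
/-- A local frame of `A` at `x₀` and its dual frame, both multiplied by a bump function and thereby
defined on all of `M`. -/
structure BumpFrame (x₀ : M) where
  /-- the frame -/
  e : Fin (Module.finrank ℝ F) → Cₛ^∞⟮I; F, A⟯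
  /-- the dual frame -/
  c : Fin (Module.finrank ℝ F) → ∀ x, A x →ₗ[ℝ] ℝ
  /-- the square of the bump function -/
  χ : C^∞⟮I, M; ℝ⟯
  contMDiff_c : ∀ j, ContMDiff (I.prod 𝓘(ℝ, F)) 𝓘(ℝ) ∞ (fun q : TotalSpace F A => c j q.1 q.2)
  eventually_eq_one : ∀ᶠ x in nhds x₀, χ x = 1
  sum_smul : ∀ x v, ∑ j, c j x v • e j x = χ x • v
  c_e : ∀ j k, c j x₀ (e k x₀) = if j = k then 1 else 0

variable [FiniteDimensional ℝ F] [ContMDiffVectorBundle ∞ F A I]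

open Filter Topology in
variable (I F A) in
theorem nonempty_bumpFrame (x₀ : M) : Nonempty (BumpFrame I F A x₀) := by
  let b := Module.finBasis ℝ F
  let t := trivializationAt F A x₀
  have hx₀ : x₀ ∈ t.baseSet := mem_baseSet_trivializationAt F A x₀
  have hU : t.baseSet ∈ 𝓝 x₀ := t.open_baseSet.mem_nhds hx₀
  obtain ⟨f, hf, -⟩ := (SmoothBumpFunction.nhds_basis_support (I := I) hU).mem_iff.1 hU
  have hcoord : ∀ {x : M} (hx : x ∈ t.baseSet) (v : A x) j,
      b.coord j (t.linearMapAt ℝ x v) = (t.basisAt b hx).repr v j := by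
    intro x hx v j
    simp [Bundle.Trivialization.basisAt, t.coe_linearMapAt_of_mem hx]
  refine ⟨⟨fun j => ⟨fun x => f x • t.localFrame b j x, ?_⟩,
    fun j x => f x • (b.coord j ∘ₗ t.linearMapAt ℝ x), ⟨fun x => f x * f x,
      f.contMDiff.mul f.contMDiff⟩, ?_, ?_, ?_, ?_⟩⟩
  · exact ContMDiffOn.smul_section_of_tsupport f.contMDiff.contMDiffOn t.open_baseSet hf
      (t.contMDiffOn_localFrame_baseSet ∞ b j)
  · intro j p
    by_cases hp : p.1 ∈ tsupport f
    · have hpt : p ∈ t.source := t.mem_source.2 (hf hp)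
      have h1 : ContMDiffAt (I.prod 𝓘(ℝ, F)) 𝓘(ℝ, F) ∞ (fun q => (t q).2) p :=
        ((t.contMDiffOn (IB := I) (n := ∞)).contMDiffAt (t.open_source.mem_nhds hpt)).snd
      have h2 := (LinearMap.toContinuousLinearMap (b.coord j)).contMDiff.contMDiffAt
        (n := ∞) (x := (t p).2) |>.comp p h1
      refine ((f.contMDiff.contMDiffAt.comp p
        (contMDiffAt_proj A)).smul h2).congr_of_eventuallyEq ?_
      filter_upwards [t.open_source.mem_nhds hpt] with q hq
      simp [t.coe_linearMapAt_of_mem (t.mem_source.1 hq)]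
    · refine (contMDiffAt_const (c := (0 : ℝ))).congr_of_eventuallyEq ?_
      have : ∀ᶠ q : TotalSpace F A in 𝓝 p, q.1 ∈ (tsupport f)ᶜ :=
        (FiberBundle.continuous_proj F A).continuousAt.eventually
          ((isClosed_tsupport f).isOpen_compl.mem_nhds hp)
      filter_upwards [this] with q hq
      simp [image_eq_zero_of_notMem_tsupport hq]
  · filter_upwards [f.eventuallyEq_one] with x hx
    change f x * f x = 1
    rw [hx]; simp
  · intro x v
    by_cases hx : x ∈ tsupport f
    · conv_rhs => rw [← (t.basisAt b (hf hx)).sum_repr v]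
      rw [Finset.smul_sum]
      refine Finset.sum_congr rfl fun j _ => ?_
      change (f x • b.coord j (t.linearMapAt ℝ x v)) • f x • t.localFrame b j x =
        (f x * f x) • _
      rw [hcoord (hf hx), t.localFrame_apply_of_mem_baseSet b (hf hx), smul_smul, smul_smul,
        smul_eq_mul]
      congr 1; ring
    · change ∑ j : Fin (Module.finrank ℝ F), (f x • b.coord j (t.linearMapAt ℝ x v)) •
        f x • t.localFrame b j x = (f x * f x) • v
      simp [image_eq_zero_of_notMem_tsupport hx]
  · intro j k
    change f x₀ • b.coord j (t.linearMapAt ℝ x₀ (f x₀ • t.localFrame b k x₀)) = _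
    rw [f.eq_one, one_smul, one_smul, hcoord hx₀, t.localFrame_apply_of_mem_baseSet b hx₀,
      Module.Basis.repr_self, Finsupp.single_apply]
    simp only [eq_comm]

namespace BumpFrame

variable {x₀ : M} (β : BumpFrame I F A x₀)

theorem χ_self : β.χ x₀ = 1 := β.eventually_eq_one.self_of_nhds

/-- The `j`-th coefficient of sections with respect to a bump frame. -/
def coeff (j : Fin (Module.finrank ℝ F)) : Cₛ^∞⟮I; F, A⟯ →ₗ[C^∞⟮I, M; ℝ⟯] C^∞⟮I, M; ℝ⟯ where
  toFun s := ⟨fun x => β.c j x (s x), (β.contMDiff_c j).comp s.contMDiff⟩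
  map_add' s t := by ext x; exact map_add (β.c j x) (s x) (t x)
  map_smul' f s := by ext x; exact map_smul (β.c j x) (f x) (s x)

theorem sum_coeff_smul (s : Cₛ^∞⟮I; F, A⟯) : ∑ j, β.coeff j s • β.e j = β.χ • s := by
  ext x
  rw [sum_section_apply]
  exact β.sum_smul x (s x)

end BumpFrame

theorem exists_section_apply_eq {x : M} (v : A x) : ∃ s : Cₛ^∞⟮I; F, A⟯, s x = v := by
  obtain ⟨β⟩ := nonempty_bumpFrame I F A x
  let c' : Fin (Module.finrank ℝ F) → C^∞⟮I, M; ℝ⟯ :=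
    fun j => ⟨fun _ => β.c j x v, contMDiff_const⟩
  refine ⟨∑ j, c' j • β.e j, ?_⟩
  rw [sum_section_apply]
  exact (β.sum_smul x v).trans (by rw [β.χ_self, one_smul])

/-- The value at `x` of a map linear over the smooth functions depends only on the value of the
section at `x`: multiplied by a function that is `1` at `x`, the section becomes a combination of
global sections with coefficients vanishing at `x`. -/
theorem apply_eq_zero_of_apply_eq_zero
    (L : Cₛ^∞⟮I; F, A⟯ →ₗ[C^∞⟮I, M; ℝ⟯] Cₛ^∞⟮I; F', A'⟯) {s : Cₛ^∞⟮I; F, A⟯} {x : M}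
    (hs : s x = 0) : L s x = 0 := by
  obtain ⟨β⟩ := nonempty_bumpFrame I F A x
  have h := congrArg (fun u => L u x) (β.sum_coeff_smul s)
  simp only [map_sum, map_smul, sum_section_apply, smul_section_apply, β.χ_self, one_smul] at h
  rw [← h]
  refine Finset.sum_eq_zero fun j _ => ?_
  have : β.coeff j s x = 0 := (congrArg (β.c j x) hs).trans (map_zero _)
  rw [this, zero_smul]

theorem apply_eq_of_apply_eq
    (L : Cₛ^∞⟮I; F, A⟯ →ₗ[C^∞⟮I, M; ℝ⟯] Cₛ^∞⟮I; F', A'⟯) {s t : Cₛ^∞⟮I; F, A⟯} {x : M}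
    (h : s x = t x) : L s x = L t x := by
  have h1 := apply_eq_zero_of_apply_eq_zero L (s := s - t) (x := x) (sub_eq_zero.2 h)
  rw [map_sub] at h1
  exact sub_eq_zero.1 h1

/-- A map of sections that is linear over the smooth functions comes from a morphism of vector
bundles. -/
theorem exists_onSections_eq [ContMDiffVectorBundle ∞ F' A' I]
    (L : Cₛ^∞⟮I; F, A⟯ →ₗ[C^∞⟮I, M; ℝ⟯] Cₛ^∞⟮I; F', A'⟯) :
    ∃ φ : VBMap I F A F' A', φ.onSections = L := by
  choose σ hσ using fun (x : M) (v : A x) => exists_section_apply_eq (I := I) (F := F) v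
  refine ⟨⟨fun x => ⟨⟨fun v => L (σ x v) x, fun v w => ?_⟩, fun r v => ?_⟩, fun p => ?_⟩, ?_⟩
  · change _ = (L (σ x v) + L (σ x w)) x
    rw [← map_add]
    refine apply_eq_of_apply_eq L ?_
    change _ = σ x v x + σ x w x
    simp only [hσ]
  · let r' : C^∞⟮I, M; ℝ⟯ := ⟨fun _ => r, contMDiff_const⟩
    change _ = (r' • L (σ x v)) x
    rw [← map_smul]
    refine apply_eq_of_apply_eq L ?_
    change _ = r • σ x v x
    simp only [hσ]
  · obtain ⟨β⟩ := nonempty_bumpFrame I F A p.1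
    -- near `p` the map is `v ↦ ∑ c j v • L (e j)`
    have h2 : ∀ᶠ q : TotalSpace F A in nhds p,
        L (σ q.1 q.2) q.1 = ∑ j, β.c j q.1 q.2 • L (β.e j) q.1 := by
      filter_upwards [(FiberBundle.continuous_proj F A).continuousAt.eventually
        β.eventually_eq_one] with q hq
      have h := congrArg (fun u => L u q.1) (β.sum_coeff_smul (σ q.1 q.2))
      simp only [map_sum, map_smul, sum_section_apply, smul_section_apply] at h
      rw [hq, one_smul] at h
      rw [← h]
      refine Finset.sum_congr rfl fun j _ => ?_
      change β.c j q.1 (σ q.1 q.2 q.1) • _ = _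
      rw [hσ]
    rw [contMDiffAt_totalSpace]
    refine ⟨contMDiffAt_proj A, ?_⟩
    let t' := trivializationAt F' A' p.1
    have hp' : p.1 ∈ t'.baseSet := mem_baseSet_trivializationAt F' A' p.1
    have h3 : ContMDiffAt (I.prod 𝓘(ℝ, F)) 𝓘(ℝ, F') ∞ (fun q : TotalSpace F A =>
        ∑ j, β.c j q.1 q.2 • (t' ⟨q.1, L (β.e j) q.1⟩).2) p := by
      refine contMDiffAt_finsetSum fun j _ => ((β.contMDiff_c j) p).smul ?_
      have := (t'.contMDiffAt_section_iff hp').1 (L (β.e j)).contMDiff.contMDiffAt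
      exact this.comp p (contMDiffAt_proj A)
    refine h3.congr_of_eventuallyEq ?_
    filter_upwards [h2, (FiberBundle.continuous_proj F A).continuousAt.eventually
      (t'.open_baseSet.mem_nhds hp')] with q hq hq'
    change (t' ⟨q.1, L (σ q.1 q.2) q.1⟩).2 = _
    rw [hq]
    have : ∀ v, (t' ⟨q.1, v⟩).2 = t'.linearMapAt ℝ q.1 v := fun v =>
      (congrFun (t'.coe_linearMapAt_of_mem hq') v).symm
    simp only [this, map_sum, map_smul]
  · ext s x
    exact apply_eq_of_apply_eq L (hσ x (s x))

/-! ### Surjectivity on sections -/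

/-- A map to sections that is linear over the smooth functions, attains every value at every point
and has image stable under locally finite sums is surjective. The domain need not consist of
sections of a bundle. -/
theorem surjective_of_forall_exists_apply_eq {N : Type*} [AddCommGroup N]
    [Module C^∞⟮I, M; ℝ⟯ N] (Φ : N →ₗ[C^∞⟮I, M; ℝ⟯] Cₛ^∞⟮I; F, A⟯)
    (hcl : ∀ (ρ : SmoothPartitionOfUnity M I M univ) (n : M → N),
      lfSum ρ (fun i => Φ (n i)) ∈ LinearMap.range Φ)
    (hpt : ∀ x (v : A x), ∃ n, Φ n x = v) : Function.Surjective Φ := by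
  intro t
  refine mem_of_forall_exists_smul_mem (LinearMap.range Φ) (fun ρ s hs => ?_) t fun x => ?_
  · choose n hn using hs
    simpa only [hn] using hcl ρ n
  obtain ⟨β⟩ := nonempty_bumpFrame I F A x
  choose n hn using fun k => hpt x (β.e k x)
  -- `m` is the matrix of the `Φ (n k)` in the frame, equal to `1` at `x`. Solving for the
  -- coefficients with the adjugate instead of the inverse keeps everything globally defined.
  let m : Matrix (Fin (Module.finrank ℝ F)) (Fin (Module.finrank ℝ F)) C^∞⟮I, M; ℝ⟯ :=
    Matrix.of fun j k => β.coeff j (Φ (n k))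
  have hm : m.map (ContMDiffMap.evalRingHom x) = 1 := by
    ext j k
    change β.c j x (Φ (n k) x) = _
    rw [hn, β.c_e, Matrix.one_apply]
  let ct : Fin (Module.finrank ℝ F) → C^∞⟮I, M; ℝ⟯ := fun j => β.coeff j t
  let y := m.adjugate.mulVec ct
  have hy : m.mulVec y = m.det • ct := by
    rw [Matrix.mulVec_mulVec, Matrix.mul_adjugate, Matrix.smul_mulVec, Matrix.one_mulVec]
  have hc : ∀ j, β.coeff j (Φ (∑ k, y k • n k)) = m.det * β.coeff j t := by
    intro j
    refine Eq.trans ?_ (congrFun hy j)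
    simp only [map_sum, map_smul, Matrix.mulVec, dotProduct, m, Matrix.of_apply, smul_eq_mul,
      mul_comm (y _)]
  refine ⟨β.χ * m.det, ?_, β.χ • ∑ k, y k • n k, ?_⟩
  · have h : m.det x = 1 := by
      change ContMDiffMap.evalRingHom x m.det = 1
      rw [RingHom.map_det]
      exact (congrArg Matrix.det hm).trans Matrix.det_one
    change β.χ x * m.det x ≠ 0
    rw [h, β.χ_self]
    norm_num
  · rw [map_smul, ← β.sum_coeff_smul, mul_comm, mul_smul, ← β.sum_coeff_smul, Finset.smul_sum]
    refine Finset.sum_congr rfl fun j _ => ?_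
    rw [hc, mul_smul]

/-- A fibrewise surjective morphism of vector bundles is surjective on sections. -/
theorem VBMap.onSections_surjective [FiniteDimensional ℝ F'] [ContMDiffVectorBundle ∞ F' A' I]
    (φ : VBMap I F A F' A') (h : ∀ x, Function.Surjective (φ.toFun x)) :
    Function.Surjective φ.onSections := by
  refine surjective_of_forall_exists_apply_eq _ (fun ρ n => ⟨lfSum ρ n, φ.onSections_lfSum ρ n⟩)
    fun x v => ?_
  obtain ⟨a, rfl⟩ := h x v
  obtain ⟨s, rfl⟩ := exists_section_apply_eq (I := I) (F := F) a
  exact ⟨s, rfl⟩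

/-! ### Lifting maps defined on sections -/

/-- A substitute for the projectivity of the module of sections: linear maps lift through a
surjection `p` if the weighted sums `S ρ` exist on its source and preserve its kernel. Lifts over
domains of local frames are glued by a partition of unity. -/
theorem exists_lift {N Q : Type*} [AddCommGroup N] [Module C^∞⟮I, M; ℝ⟯ N]
    [AddCommGroup Q] [Module C^∞⟮I, M; ℝ⟯ Q] (p : N →ₗ[C^∞⟮I, M; ℝ⟯] Q)
    (hp : Function.Surjective p)
    (S : SmoothPartitionOfUnity M I M univ → (M → N) →ₗ[C^∞⟮I, M; ℝ⟯] N)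
    (hS : ∀ (ρ : SmoothPartitionOfUnity M I M univ) (χ : M → C^∞⟮I, M; ℝ⟯),
      (∀ i x, ρ i x * χ i x = ρ i x) → ∀ n, S ρ (fun i => χ i • n) = n)
    (hker : ∀ ρ n, (∀ i, p (n i) = 0) → p (S ρ n) = 0)
    (Ξ : Cₛ^∞⟮I; F, A⟯ →ₗ[C^∞⟮I, M; ℝ⟯] Q) :
    ∃ L : Cₛ^∞⟮I; F, A⟯ →ₗ[C^∞⟮I, M; ℝ⟯] N, ∀ s, p (L s) = Ξ s := by
  let β := fun x => (nonempty_bumpFrame I F A x).some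
  obtain ⟨ρ, hρ⟩ := exists_partitionOfUnity_mul_eq (fun x => (β x).χ)
    fun x => (β x).eventually_eq_one
  choose n hn using fun x j => hp (Ξ ((β x).e j))
  refine ⟨S ρ ∘ₗ LinearMap.pi fun i => ∑ j, ((β i).coeff j).smulRight (n i j), fun s => ?_⟩
  obtain ⟨n₀, hn₀⟩ := hp (Ξ s)
  rw [← hn₀, ← sub_eq_zero, ← map_sub]
  nth_rw 1 [← hS ρ _ hρ n₀]
  rw [LinearMap.comp_apply, ← map_sub]
  refine hker ρ _ fun i => ?_
  simp only [Pi.sub_apply, LinearMap.pi_apply, LinearMap.sum_apply, LinearMap.smulRight_apply,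
    map_sub, map_sum, map_smul, hn, hn₀]
  rw [sub_eq_zero]
  simp only [← map_smul, ← map_sum, (β i).sum_coeff_smul]

end Sections

section Operators

variable {E : Type*} [NormedAddCommGroup E] [NormedSpace ℝ E] {H : Type*} [TopologicalSpace H]
  {I : ModelWithCorners ℝ E H} {M : Type*} [TopologicalSpace M] [ChartedSpace H M]
  {F : Type*} [NormedAddCommGroup F] [NormedSpace ℝ F] {K : M → Type*}
  [TopologicalSpace (TotalSpace F K)] [∀ x, TopologicalSpace (K x)] [FiberBundle F K]
  [∀ x, LieRing (K x)] [∀ x, LieAlgebra ℝ (K x)] [VectorBundle ℝ F K]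
  [ContMDiffVectorBundle ∞ F K I] [IsManifold I ∞ M] [LieAlgebraBundle I F K]

/-! ### The Lie algebra of sections of `CDO[K]` -/

/-- The commutator bracket makes the sections of `CDO[K]` a Lie ring. -/
instance : LieRing (CDO I F K) where
  add_lie D D' D'' := by
    refine CDO.ext (fun V => ?_) (Derivation.ext fun f => by
      simp only [CDO.symbol_lie, map_add, Derivation.commutator_apply, Derivation.add_apply]
      abel)
    change (D.op _ + D'.op _) - D''.op (D.op V + D'.op V) =
      (D.op _ - D''.op (D.op V)) + (D'.op _ - D''.op (D'.op V))
    rw [map_add]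
    abel
  lie_add D D' D'' := by
    refine CDO.ext (fun V => ?_) (Derivation.ext fun f => by
      simp only [CDO.symbol_lie, map_add, Derivation.commutator_apply, Derivation.add_apply]
      abel)
    change D.op (D'.op V + D''.op V) - (D'.op _ + D''.op _) =
      (D.op (D'.op V) - D'.op _) + (D.op (D''.op V) - D''.op _)
    rw [map_add]
    abel
  lie_self D := CDO.ext (fun V => sub_self _) (lie_self _)
  leibniz_lie D D' D'' := by
    refine CDO.ext (fun V => ?_) (Derivation.ext fun f => by
      simp only [CDO.symbol_lie, map_add, map_sub, Derivation.commutator_apply,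
        Derivation.add_apply]
      abel)
    change ⁅D, ⁅D', D''⁆⁆.op V = ⁅⁅D, D'⁆, D''⁆.op V + ⁅D', ⁅D, D''⁆⁆.op V
    simp only [CDO.lie_op, map_sub]
    abel

theorem CDO.lie_smul (D D' : CDO I F K) (f : C^∞⟮I, M; ℝ⟯) :
    ⁅D, f • D'⁆ = f • ⁅D, D'⁆ + CDO.symbol I F K D f • D' := by
  refine CDO.ext (fun V => ?_) (Derivation.ext fun g => ?_)
  · change D.op (f • D'.op V) - f • D'.op (D.op V) =
      f • (D.op (D'.op V) - D'.op (D.op V)) + CDO.symbol I F K D f • D'.op V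
    rw [CDO.op_smul, smul_sub]
    abel
  · simp only [CDO.symbol_lie, map_smul, map_add, Derivation.commutator_apply,
      Derivation.add_apply, Derivation.smul_apply, smul_eq_mul, Derivation.leibniz]
    ring

theorem innerCDO_lie_innerCDO (V W : Cₛ^∞⟮I; F, K⟯) :
    ⁅innerCDO I F K V, innerCDO I F K W⁆ = innerCDO I F K ⁅V, W⁆ :=
  lie_innerCDO _ _

/-- The sum `∑ ρ i • g i` of functions weighted by a smooth partition of unity. -/
def lfSumFun (ρ : SmoothPartitionOfUnity M I M univ) (g : M → C^∞⟮I, M; ℝ⟯) : C^∞⟮I, M; ℝ⟯ :=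
  ⟨fun x => ∑ᶠ i, ρ i x • g i x,
    ρ.contMDiff_finsum_smul fun i _ _ => (g i).contMDiff.contMDiffAt⟩

theorem lfSumFun_apply (ρ : SmoothPartitionOfUnity M I M univ) (g : M → C^∞⟮I, M; ℝ⟯) (x : M) :
    lfSumFun ρ g x = ∑ i ∈ ρ.finsupport x, ρ i x * g i x :=
  finsum_smul_eq_sum ρ x fun i => g i x

/-- The sum `∑ ρ i • δ i` of derivations weighted by a smooth partition of unity. -/
def lfSumDerivation (ρ : SmoothPartitionOfUnity M I M univ)
    (δ : M → Derivation ℝ C^∞⟮I, M; ℝ⟯ C^∞⟮I, M; ℝ⟯) :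
    Derivation ℝ C^∞⟮I, M; ℝ⟯ C^∞⟮I, M; ℝ⟯ :=
  Derivation.mk'
    { toFun := fun f => lfSumFun ρ fun i => δ i f
      map_add' := fun f g => by
        ext x
        change _ = lfSumFun ρ _ x + lfSumFun ρ _ x
        simp only [lfSumFun_apply, ← Finset.sum_add_distrib, ← mul_add, map_add]
        rfl
      map_smul' := fun c f => by
        ext x
        change _ = c * lfSumFun ρ _ x
        simp only [lfSumFun_apply, Finset.mul_sum, mul_left_comm c, Derivation.map_smul]
        rfl }
    fun f g => by
      ext x
      change lfSumFun ρ _ x = f x * lfSumFun ρ _ x + g x * lfSumFun ρ _ x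
      simp only [lfSumFun_apply, Finset.mul_sum, ← Finset.sum_add_distrib]
      refine Finset.sum_congr rfl fun i _ => ?_
      rw [Derivation.leibniz]
      change _ * (f x * _ + g x * _) = _
      ring

theorem lfSumDerivation_apply (ρ : SmoothPartitionOfUnity M I M univ)
    (δ : M → Derivation ℝ C^∞⟮I, M; ℝ⟯ C^∞⟮I, M; ℝ⟯) (f : C^∞⟮I, M; ℝ⟯) (x : M) :
    lfSumDerivation ρ δ f x = ∑ i ∈ ρ.finsupport x, ρ i x * δ i f x :=
  lfSumFun_apply ρ _ x

/-- The sum `∑ ρ i • D i` of sections of `CDO[K]` weighted by a smooth partition of unity. -/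
def CDO.lfSum (ρ : SmoothPartitionOfUnity M I M univ) :
    (M → CDO I F K) →ₗ[C^∞⟮I, M; ℝ⟯] CDO I F K where
  toFun D := ⟨({
      toFun := fun V => Algd.lfSum ρ fun i => (D i).op V
      map_add' := fun V W => by
        simp only [map_add]
        exact map_add (Algd.lfSum ρ) _ _
      map_smul' := fun c V => by
        ext x
        change _ = c • Algd.lfSum ρ (fun i => (D i).op V) x
        simp only [lfSum_apply, Finset.smul_sum, smul_comm c, map_smul]
        rfl }, lfSumDerivation ρ fun i => CDO.symbol I F K (D i)), by
    refine ⟨fun f V => ?_, fun V W => ?_⟩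
    · ext x
      change Algd.lfSum ρ _ x = f x • Algd.lfSum ρ _ x + lfSumDerivation ρ _ f x • V x
      simp only [lfSum_apply, lfSumDerivation_apply, Finset.smul_sum, Finset.sum_smul,
        ← Finset.sum_add_distrib]
      refine Finset.sum_congr rfl fun i _ => ?_
      rw [CDO.op_smul]
      change ρ i x • (f x • (D i).op V x + CDO.symbol I F K (D i) f x • V x) = _
      module
    · ext x
      change Algd.lfSum ρ _ x = ⁅Algd.lfSum ρ _ x, W x⁆ + ⁅V x, Algd.lfSum ρ _ x⁆
      simp only [lfSum_apply, sum_lie, lie_sum, ← Finset.sum_add_distrib]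
      refine Finset.sum_congr rfl fun i _ => ?_
      rw [CDO.op_lie, smul_lie, _root_.lie_smul, ← smul_add]
      rfl⟩
  map_add' D D' := by
    refine CDO.ext (fun V => map_add (Algd.lfSum ρ) _ _) (Derivation.ext fun f => ?_)
    ext x
    change lfSumDerivation ρ _ f x = lfSumDerivation ρ _ f x + lfSumDerivation ρ _ f x
    simp only [lfSumDerivation_apply, ← Finset.sum_add_distrib, ← mul_add]
    rfl
  map_smul' g D := by
    refine CDO.ext (fun V => map_smul (Algd.lfSum ρ) g _) (Derivation.ext fun f => ?_)
    ext x
    change lfSumDerivation ρ _ f x = g x * lfSumDerivation ρ _ f x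
    simp only [lfSumDerivation_apply, Finset.mul_sum, mul_left_comm (g x)]
    rfl

theorem CDO.lfSum_smul_const (ρ : SmoothPartitionOfUnity M I M univ)
    {χ : M → C^∞⟮I, M; ℝ⟯} (h : ∀ i x, ρ i x * χ i x = ρ i x) (D : CDO I F K) :
    CDO.lfSum ρ (fun i => χ i • D) = D := by
  refine CDO.ext (fun V => Algd.lfSum_smul_const ρ h (D.op V)) (Derivation.ext fun f => ?_)
  ext x
  exact (lfSumDerivation_apply ρ _ f x).trans
    (sum_finsupport_smul_smul ρ h x (CDO.symbol I F K D f x))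

theorem CDO.lfSum_innerCDO (ρ : SmoothPartitionOfUnity M I M univ) (V : M → Cₛ^∞⟮I; F, K⟯) :
    CDO.lfSum ρ (fun i => innerCDO I F K (V i)) = innerCDO I F K (Algd.lfSum ρ V) := by
  refine CDO.ext (fun W => ?_) (Derivation.ext fun f => ?_)
  · ext x
    change Algd.lfSum ρ (fun i => ⁅V i, W⁆) x = ⁅Algd.lfSum ρ V x, W x⁆
    simp only [lfSum_apply, sum_lie, smul_lie]
    rfl
  · ext x
    refine (lfSumDerivation_apply ρ _ f x).trans (Finset.sum_eq_zero fun i _ => ?_)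
    rw [symbol_innerCDO]
    exact mul_zero _

end Operators

section LocallyFinite

variable {E : Type*} [NormedAddCommGroup E] [NormedSpace ℝ E] [FiniteDimensional ℝ E]
  {H : Type*} [TopologicalSpace H]
  {I : ModelWithCorners ℝ E H} {M : Type*} [TopologicalSpace M] [ChartedSpace H M]
  [IsManifold I ∞ M] [T2Space M] [SigmaCompactSpace M]
  {F₁ : Type*} [NormedAddCommGroup F₁] [NormedSpace ℝ F₁] {A₁ : M → Type*}
  [TopologicalSpace (TotalSpace F₁ A₁)] [∀ x, TopologicalSpace (A₁ x)] [FiberBundle F₁ A₁]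
  [∀ x, AddCommGroup (A₁ x)] [∀ x, Module ℝ (A₁ x)] [VectorBundle ℝ F₁ A₁]
  [FiniteDimensional ℝ F₁] [ContMDiffVectorBundle ∞ F₁ A₁ I]
  {F₂ : Type*} [NormedAddCommGroup F₂] [NormedSpace ℝ F₂] {A₂ : M → Type*}
  [TopologicalSpace (TotalSpace F₂ A₂)] [∀ x, TopologicalSpace (A₂ x)] [FiberBundle F₂ A₂]
  [∀ x, AddCommGroup (A₂ x)] [∀ x, Module ℝ (A₂ x)] [VectorBundle ℝ F₂ A₂]
  [FiniteDimensional ℝ F₂] [ContMDiffVectorBundle ∞ F₂ A₂ I]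
  {F₃ : Type*} [NormedAddCommGroup F₃] [NormedSpace ℝ F₃] {A₃ : M → Type*}
  [TopologicalSpace (TotalSpace F₃ A₃)] [∀ x, TopologicalSpace (A₃ x)] [FiberBundle F₃ A₃]
  [∀ x, AddCommGroup (A₃ x)] [∀ x, Module ℝ (A₃ x)] [VectorBundle ℝ F₃ A₃]
  [FiniteDimensional ℝ F₃] [ContMDiffVectorBundle ∞ F₃ A₃ I]

/-! ### Splittings and exactness on sections -/

theorem VBMap.exists_rightInverse (φ : VBMap I F₁ A₁ F₂ A₂)
    (h : ∀ x, Function.Surjective (φ.toFun x)) :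
    ∃ σ : VBMap I F₂ A₂ F₁ A₁, ∀ s, φ.onSections (σ.onSections s) = s := by
  obtain ⟨L, hL⟩ := exists_lift φ.onSections (φ.onSections_surjective h) lfSum
    (fun ρ χ hρ s => lfSum_smul_const ρ hρ s)
    (fun ρ n hn => by
      rw [φ.onSections_lfSum, show (fun i => φ.onSections (n i)) = 0 from funext hn, map_zero])
    LinearMap.id
  obtain ⟨σ, rfl⟩ := exists_onSections_eq L
  exact ⟨σ, hL⟩

/-- An exact sequence `A₁ → A₂ → A₃ → 0` of vector bundles is exact at `A₂` on sections. No constant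
rank hypothesis on `φ` is needed: for a splitting `σ` of `ψ`, the map `φ + σ : A₁ ⊕ A₃ → A₂` is
fibrewise surjective. -/
theorem VBMap.exists_onSections_eq_of_exact (φ : VBMap I F₁ A₁ F₂ A₂) (ψ : VBMap I F₂ A₂ F₃ A₃)
    (h : ∀ x, Function.Surjective (ψ.toFun x))
    (hex : ∀ x, LinearMap.ker (ψ.toFun x) = LinearMap.range (φ.toFun x))
    {a : Cₛ^∞⟮I; F₂, A₂⟯} (ha : ψ.onSections a = 0) : ∃ v, φ.onSections v = a := by
  obtain ⟨σ, hσ⟩ := ψ.exists_rightInverse h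
  have hψφ : ∀ v, ψ.onSections (φ.onSections v) = 0 := fun v => by
    ext x
    have : φ.toFun x (v x) ∈ LinearMap.ker (ψ.toFun x) := by
      rw [hex]
      exact LinearMap.mem_range_self _ _
    exact this
  let Φ := LinearMap.coprod φ.onSections σ.onSections
  have hΦ : Function.Surjective Φ := by
    refine surjective_of_forall_exists_apply_eq Φ (fun ρ n => ?_) fun x v => ?_
    · refine ⟨(lfSum ρ fun i => (n i).1, lfSum ρ fun i => (n i).2), ?_⟩
      simp only [Φ, LinearMap.coprod_apply, VBMap.onSections_lfSum]
      exact (map_add (lfSum ρ) _ _).symm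
    · obtain ⟨X, hX⟩ := exists_section_apply_eq (I := I) (F := F₃) (ψ.toFun x v)
      have hv : v - σ.onSections X x ∈ LinearMap.ker (ψ.toFun x) := by
        have : ψ.toFun x (σ.onSections X x) = X x :=
          congrArg (fun s => s x) (hσ X)
        rw [LinearMap.mem_ker, map_sub, this, hX, sub_self]
      rw [hex] at hv
      obtain ⟨u, hu⟩ := hv
      obtain ⟨V, rfl⟩ := exists_section_apply_eq (I := I) (F := F₁) u
      refine ⟨(V, X), ?_⟩
      change φ.toFun x (V x) + σ.onSections X x = v
      rw [hu, sub_add_cancel]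
  obtain ⟨⟨v, X⟩, rfl⟩ := hΦ a
  have hX : X = 0 := by
    rw [← ha, LinearMap.coprod_apply, map_add, hψφ, hσ, zero_add]
  exact ⟨v, by simp [Φ, hX]⟩

end LocallyFinite

section Algebroids

variable {E : Type*} [NormedAddCommGroup E] [NormedSpace ℝ E]
  {H : Type*} [TopologicalSpace H] {I : ModelWithCorners ℝ E H}
  {M : Type*} [TopologicalSpace M] [ChartedSpace H M] [IsManifold I ∞ M]
  {F : Type*} [NormedAddCommGroup F] [NormedSpace ℝ F] [FiniteDimensional ℝ F] {K : M → Type*}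
  [TopologicalSpace (TotalSpace F K)] [∀ x, TopologicalSpace (K x)] [FiberBundle F K]
  [∀ x, LieRing (K x)] [∀ x, LieAlgebra ℝ (K x)] [VectorBundle ℝ F K]
  [ContMDiffVectorBundle ∞ F K I] [LieAlgebraBundle I F K]
  {FB : Type*} [NormedAddCommGroup FB] [NormedSpace ℝ FB] {B : M → Type*}
  [TopologicalSpace (TotalSpace FB B)] [∀ x, TopologicalSpace (B x)] [FiberBundle FB B]
  [∀ x, AddCommGroup (B x)] [∀ x, Module ℝ (B x)] [VectorBundle ℝ FB B]
  {ℬ : LieAlgebroid I FB B}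
  {FA : Type*} [NormedAddCommGroup FA] [NormedSpace ℝ FA] {A : M → Type*}
  [TopologicalSpace (TotalSpace FA A)] [∀ x, TopologicalSpace (A x)] [FiberBundle FA A]
  [∀ x, AddCommGroup (A x)] [∀ x, Module ℝ (A x)] [VectorBundle ℝ FA A]

/-! ### Pulling back a bracket -/

/-- A bundle `A` with a map `proj` to a Lie algebroid `B` and a map `ρ` to `CDO[K]` that are jointly
injective on sections, with image stable under the brackets, inherits a Lie algebroid structure. -/
theorem exists_algebroid_of_jointly_injective (ℬ : LieAlgebroid I FB B) (proj : VBMap I FA A FB B)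
    (ρ : Cₛ^∞⟮I; FA, A⟯ →ₗ[C^∞⟮I, M; ℝ⟯] CDO I F K)
    (hinj : ∀ a b, proj.onSections a = proj.onSections b → ρ a = ρ b → a = b)
    (hcl : ∀ a b, ∃ c, proj.onSections c = ℬ.bracket (proj.onSections a) (proj.onSections b) ∧
      ρ c = ⁅ρ a, ρ b⁆)
    (hsymb : ∀ a, CDO.symbol I F K (ρ a) = ℬ.anchorDerivation (proj.onSections a)) :
    ∃ 𝒜 : LieAlgebroid I FA A, 𝒜.anchor = ℬ.anchor.comp proj ∧
      (∀ a b, proj.onSections (𝒜.bracket a b) =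
        ℬ.bracket (proj.onSections a) (proj.onSections b)) ∧
      ∀ a b, ρ (𝒜.bracket a b) = ⁅ρ a, ρ b⁆ := by
  choose br hbr₁ hbr₂ using hcl
  -- real scalars act as constant functions, to which the Leibniz rules apply
  have hconst : ∀ (r : ℝ) (s : Cₛ^∞⟮I; FA, A⟯), r • s = algebraMap ℝ C^∞⟮I, M; ℝ⟯ r • s :=
    fun r s => (algebraMap_smul C^∞⟮I, M; ℝ⟯ r s).symm
  have hconst' : ∀ (r : ℝ) (s : Cₛ^∞⟮I; FB, B⟯), r • s = algebraMap ℝ C^∞⟮I, M; ℝ⟯ r • s :=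
    fun r s => (algebraMap_smul C^∞⟮I, M; ℝ⟯ r s).symm
  have hlie : ∀ (r : ℝ) (D D' : CDO I F K), ⁅D, algebraMap ℝ C^∞⟮I, M; ℝ⟯ r • D'⁆ =
      algebraMap ℝ C^∞⟮I, M; ℝ⟯ r • ⁅D, D'⁆ := fun r D D' => by
    rw [CDO.lie_smul, Derivation.map_algebraMap, zero_smul, add_zero]
  refine ⟨{
    anchor := ℬ.anchor.comp proj
    bracket := LinearMap.mk₂ ℝ br ?_ ?_ ?_ ?_
    bracket_self := ?_
    jacobi := ?_
    bracket_smul := ?_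
    anchor_bracket := ?_ }, rfl, hbr₁, hbr₂⟩
  · intro a a' b
    refine hinj _ _ ?_ ?_
    · simp only [hbr₁, map_add, LinearMap.add_apply]
    · simp only [hbr₂, map_add, add_lie]
  · intro r a b
    refine hinj _ _ ?_ ?_
    · rw [hconst, hconst r (br a b), map_smul, hbr₁, hbr₁, map_smul, ← hconst', ← hconst',
        map_smul, LinearMap.smul_apply]
    · rw [hconst, hconst r (br a b), map_smul, hbr₂, hbr₂, map_smul, ← lie_skew, hlie,
        ← smul_neg, lie_skew]
  · intro a b b'
    refine hinj _ _ ?_ ?_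
    · simp only [hbr₁, map_add]
    · simp only [hbr₂, map_add, lie_add]
  · intro r a b
    refine hinj _ _ ?_ ?_
    · rw [hconst, hconst r (br a b), map_smul, hbr₁, hbr₁, map_smul, ← hconst', ← hconst',
        map_smul]
    · rw [hconst, hconst r (br a b), map_smul, hbr₂, hbr₂, map_smul, hlie]
  · intro a
    refine hinj _ _ ?_ ?_
    · rw [LinearMap.mk₂_apply, hbr₁, ℬ.bracket_self, map_zero]
    · rw [LinearMap.mk₂_apply, hbr₂, lie_self, map_zero]
  · intro a b c
    simp only [LinearMap.mk₂_apply]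
    refine hinj _ _ ?_ ?_
    · rw [map_add, hbr₁, hbr₁, hbr₁, hbr₁, hbr₁, hbr₁, ℬ.jacobi]
    · rw [map_add, hbr₂, hbr₂, hbr₂, hbr₂, hbr₂, hbr₂]
      exact leibniz_lie _ _ _
  · intro a f b
    change br a (f • b) = f • br a b + ℬ.anchorDerivation (proj.onSections a) f • b
    refine hinj _ _ ?_ ?_
    · rw [map_add, map_smul, map_smul, hbr₁, hbr₁, map_smul, ℬ.bracket_smul]
      rfl
    · rw [map_add, map_smul, map_smul, hbr₂, hbr₂, map_smul, CDO.lie_smul, hsymb]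
  · intro a b
    change ℬ.anchorDerivation (proj.onSections (br a b)) = _
    rw [hbr₁]
    exact ℬ.anchor_bracket _ _

/-! ### Sections of `ad(K)` and of direct sums -/

theorem adCDO_ad (V : Cₛ^∞⟮I; F, K⟯) : adCDO (VBMap.ad.onSections V) = innerCDO I F K V :=
  CDO.ext (fun _ => rfl) rfl

theorem section_prod_ext {X Y : Cₛ^∞⟮I; FB × FA, B ×ᵇ A⟯}
    (h₁ : VBMap.fst.onSections X = VBMap.fst.onSections Y)
    (h₂ : VBMap.snd.onSections X = VBMap.snd.onSections Y) : X = Y := by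
  exact ContMDiffSection.ext fun x =>
    Prod.ext (congrArg (fun s => s x) h₁) (congrArg (fun s => s x) h₂)

theorem sectionProd_fst_snd (X : Cₛ^∞⟮I; FB × FA, B ×ᵇ A⟯) :
    sectionProd (VBMap.fst.onSections X) (VBMap.snd.onSections X) = X := rfl

theorem sumRho_sectionProd_ad (nabla : Cₛ^∞⟮I; FB, B⟯ →ₗ[C^∞⟮I, M; ℝ⟯] CDO I F K)
    (X : Cₛ^∞⟮I; FB, B⟯) (V : Cₛ^∞⟮I; F, K⟯) :
    sumRho nabla (sectionProd X (VBMap.ad.onSections V)) = nabla X + innerCDO I F K V := by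
  rw [← adCDO_ad]
  rfl

theorem Covers.symbol_eq {Ξ : Coupling F K ℬ}
    {nabla : Cₛ^∞⟮I; FB, B⟯ →ₗ[C^∞⟮I, M; ℝ⟯] CDO I F K} (h : Covers nabla Ξ)
    (X : Cₛ^∞⟮I; FB, B⟯) : CDO.symbol I F K (nabla X) = ℬ.anchorDerivation X := by
  rw [← Ξ.symbol_eq, ← h X]
  rfl

theorem IsCrossedModule.rho_tau_eq {τ : VBMap I F K FA A} {𝒜 : LieAlgebroid I FA A}
    {ρ : Cₛ^∞⟮I; FA, A⟯ →ₗ[C^∞⟮I, M; ℝ⟯] CDO I F K} (h : IsCrossedModule τ 𝒜 ρ)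
    (V : Cₛ^∞⟮I; F, K⟯) : ρ (τ.onSections V) = innerCDO I F K V := by
  refine CDO.ext (fun W => h.rho_tau V W) ?_
  rw [h.rho_representation.symbol_eq, symbol_innerCDO]
  have : 𝒜.anchor.onSections (τ.onSections V) = 0 := by
    ext x
    exact h.tau_morphism.anchor_comp x (V x)
  change vectorFieldDerivation (𝒜.anchor.onSections (τ.onSections V)) = 0
  rw [this, map_zero]

theorem IsCokernel.proj_tau_eq {τ : VBMap I F K FA A} {𝒜 : LieAlgebroid I FA A}
    {proj : VBMap I FA A FB B} (h : IsCokernel τ 𝒜 ℬ proj)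
    (V : Cₛ^∞⟮I; F, K⟯) : proj.onSections (τ.onSections V) = 0 := by
  ext x
  have : τ.toFun x (V x) ∈ LinearMap.ker (proj.toFun x) := by
    rw [h.ker_eq]
    exact LinearMap.mem_range_self _ _
  exact this

variable [FiniteDimensional ℝ E] [T2Space M] [SigmaCompactSpace M]

theorem innerCDO_eq_zero {V : Cₛ^∞⟮I; F, K⟯} (h : innerCDO I F K V = 0) (x : M) :
    V x ∈ LieAlgebra.center ℝ (K x) := by
  rw [LieModule.mem_maxTrivSubmodule]
  intro w
  obtain ⟨W, rfl⟩ := exists_section_apply_eq (I := I) (F := F) w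
  have : (innerCDO I F K V).op W = 0 := by
    rw [h]
    rfl
  rw [← lie_skew, neg_eq_zero]
  exact congrArg (fun s => s x) this

theorem adCDO_injective : Function.Injective (adCDO (I := I) (F := F) (K := K)) := by
  rw [← LinearMap.ker_eq_bot, LinearMap.ker_eq_bot']
  intro S hS
  ext x
  refine AdFibre.toEnd_injective x (LinearMap.ext fun w => ?_)
  obtain ⟨W, rfl⟩ := exists_section_apply_eq (I := I) (F := F) w
  have : (adCDO S).op W = 0 := by
    rw [hS]
    rfl
  change _ = AdFibre.toEnd x 0 (W x)
  rw [map_zero]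
  exact congrArg (fun s => s x) this

theorem ad_onSections_surjective :
    Function.Surjective (VBMap.ad (I := I) (F := F) (K := K)).onSections :=
  VBMap.onSections_surjective _ AdFibre.ofFibre_surjective

/-! ### The twisted sum as a fibre product -/

section Twisted

variable {nabla : Cₛ^∞⟮I; FB, B⟯ →ₗ[C^∞⟮I, M; ℝ⟯] CDO I F K}

theorem sumRho_injective (a b : Cₛ^∞⟮I; FB × AdModel I F K, B ×ᵇ AdFibre K⟯)
    (h₁ : VBMap.fst.onSections a = VBMap.fst.onSections b)
    (h₂ : sumRho nabla a = sumRho nabla b) : a = b := by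
  refine section_prod_ext h₁ (adCDO_injective ?_)
  change nabla (VBMap.fst.onSections a) + _ = nabla (VBMap.fst.onSections b) + _ at h₂
  rw [h₁] at h₂
  exact add_left_cancel h₂

theorem exists_sumRho_eq {Ξ : Coupling F K ℬ} (hcov : Covers nabla Ξ) (X : Cₛ^∞⟮I; FB, B⟯)
    (D : CDO I F K) (hD : (Submodule.Quotient.mk D : OutDO I F K) = Ξ.toLinearMap X) :
    ∃ a : Cₛ^∞⟮I; FB × AdModel I F K, B ×ᵇ AdFibre K⟯,
      VBMap.fst.onSections a = X ∧ sumRho nabla a = D := by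
  rw [← hcov X, Submodule.Quotient.eq] at hD
  obtain ⟨V, hV⟩ := hD
  refine ⟨sectionProd X (VBMap.ad.onSections V), rfl, ?_⟩
  rw [sumRho_sectionProd_ad, hV, add_sub_cancel]

theorem mk_sumRho {Ξ : Coupling F K ℬ} (hcov : Covers nabla Ξ)
    (a : Cₛ^∞⟮I; FB × AdModel I F K, B ×ᵇ AdFibre K⟯) :
    (Submodule.Quotient.mk (sumRho nabla a) : OutDO I F K) =
      Ξ.toLinearMap (VBMap.fst.onSections a) := by
  obtain ⟨V, hV⟩ := ad_onSections_surjective (VBMap.snd.onSections a)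
  rw [← hcov, ← sectionProd_fst_snd a, ← hV, sumRho_sectionProd_ad, Submodule.Quotient.eq]
  exact ⟨V, (add_sub_cancel_left _ _).symm⟩

theorem symbol_sumRho {Ξ : Coupling F K ℬ} (hcov : Covers nabla Ξ)
    (a : Cₛ^∞⟮I; FB × AdModel I F K, B ×ᵇ AdFibre K⟯) :
    CDO.symbol I F K (sumRho nabla a) = ℬ.anchorDerivation (VBMap.fst.onSections a) :=
  (map_add (CDO.symbol I F K) _ _).trans ((add_zero _).trans (hcov.symbol_eq _))

/-- The bracket formula of the twisted sum says that `(fst, sumRho nabla)` preserves brackets. -/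
theorem isTwistedSum_iff {𝒜 : LieAlgebroid I (FB × AdModel I F K) (B ×ᵇ AdFibre K)} :
    IsTwistedSum ℬ nabla 𝒜 ↔ 𝒜.anchor = ℬ.anchor.comp VBMap.fst ∧
      (∀ a b, VBMap.fst.onSections (𝒜.bracket a b) =
        ℬ.bracket (VBMap.fst.onSections a) (VBMap.fst.onSections b)) ∧
      ∀ a b, sumRho nabla (𝒜.bracket a b) = ⁅sumRho nabla a, sumRho nabla b⁆ := by
  have key : ∀ (X Y : Cₛ^∞⟮I; FB, B⟯) (V W : Cₛ^∞⟮I; F, K⟯),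
      ⁅nabla X + innerCDO I F K V, nabla Y + innerCDO I F K W⁆ = nabla (ℬ.bracket X Y) +
        (innerCDO I F K ((nabla X).op W) - innerCDO I F K ((nabla Y).op V) +
          innerCDO I F K ⁅V, W⁆ - curvature ℬ nabla X Y) := by
    intro X Y V W
    rw [add_lie, lie_add, lie_add, lie_innerCDO, innerCDO_lie, innerCDO_lie_innerCDO, curvature]
    abel
  constructor
  · intro h
    refine ⟨VBMap.ext h.anchor_eq, fun a b => ?_, fun a b => ?_⟩ <;>
    obtain ⟨V, hV⟩ := ad_onSections_surjective (VBMap.snd.onSections a) <;>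
    obtain ⟨W, hW⟩ := ad_onSections_surjective (VBMap.snd.onSections b) <;>
    rw [← sectionProd_fst_snd a, ← sectionProd_fst_snd b, ← hV, ← hW]
    · exact h.fst_bracket _ _ V W
    · rw [sumRho_sectionProd_ad, sumRho_sectionProd_ad, key, ← h.snd_bracket,
        ← h.fst_bracket _ _ V W]
      rfl
  · rintro ⟨h₁, h₂, h₃⟩
    refine ⟨fun x v => by rw [h₁]; rfl, fun X Y V W => h₂ _ _, fun X Y V W => ?_⟩
    have h := h₃ (sectionProd X (VBMap.ad.onSections V)) (sectionProd Y (VBMap.ad.onSections W))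
    rw [sumRho_sectionProd_ad, sumRho_sectionProd_ad, key] at h
    have h' := h₂ (sectionProd X (VBMap.ad.onSections V)) (sectionProd Y (VBMap.ad.onSections W))
    change nabla (VBMap.fst.onSections _) + _ = _ at h
    rw [h'] at h
    exact add_left_cancel h

/-- The image of `(fst, sumRho nabla)` is stable under brackets because `Ξ` preserves them. -/
theorem existsUnique_isTwistedSum {Ξ : Coupling F K ℬ} (hcov : Covers nabla Ξ) :
    ∃! 𝒜 : LieAlgebroid I (FB × AdModel I F K) (B ×ᵇ AdFibre K), IsTwistedSum ℬ nabla 𝒜 := by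
  obtain ⟨𝒜, h⟩ := exists_algebroid_of_jointly_injective ℬ VBMap.fst (sumRho nabla)
    sumRho_injective (fun a b => exists_sumRho_eq hcov _ _ (by
      rw [← OutDO.mk_lie, mk_sumRho hcov, mk_sumRho hcov, Ξ.map_bracket])) (symbol_sumRho hcov)
  refine ⟨𝒜, isTwistedSum_iff.2 h, fun 𝒜' h' => ?_⟩
  obtain ⟨h₁', h₂', h₃'⟩ := isTwistedSum_iff.1 h'
  obtain ⟨h₁, h₂, h₃⟩ := h
  refine LieAlgebroid.ext (h₁'.trans h₁.symm) ?_
  refine LinearMap.ext fun a => LinearMap.ext fun b => sumRho_injective (nabla := nabla) _ _ ?_ ?_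
  · rw [h₂, h₂']
  · rw [h₃, h₃']

variable {𝒜 : LieAlgebroid I (FB × AdModel I F K) (B ×ᵇ AdFibre K)}

theorem sumRho_sumTau (V : Cₛ^∞⟮I; F, K⟯) :
    sumRho nabla (sumTau.onSections V) = innerCDO I F K V := by
  refine (sumRho_sectionProd_ad nabla 0 V).trans ?_
  rw [map_zero, zero_add]

theorem IsTwistedSum.isRepresentation {Ξ : Coupling F K ℬ} (hcov : Covers nabla Ξ)
    (h : IsTwistedSum ℬ nabla 𝒜) : IsRepresentation 𝒜 (sumRho nabla) := by
  obtain ⟨h₁, h₂, h₃⟩ := isTwistedSum_iff.1 h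
  refine ⟨fun a => ?_, h₃⟩
  rw [symbol_sumRho hcov]
  change _ = vectorFieldDerivation (𝒜.anchor.onSections a)
  rw [h₁]
  rfl

theorem fst_sumTau (V : Cₛ^∞⟮I; F, K⟯) :
    (VBMap.fst : VBMap I (FB × AdModel I F K) (B ×ᵇ AdFibre K) FB B).onSections
      (sumTau.onSections V) = 0 := rfl

theorem IsTwistedSum.isLieAlgebroidMorphism_sumTau (h : IsTwistedSum ℬ nabla 𝒜) :
    IsLieAlgebroidMorphism (LieAlgebraBundle.toLieAlgebroid I F K) 𝒜 sumTau := by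
  obtain ⟨-, h₂, h₃⟩ := isTwistedSum_iff.1 h
  refine ⟨fun x v => ?_, fun V W => sumRho_injective (nabla := nabla) _ _ ?_ ?_⟩
  · rw [h.anchor_eq]
    exact map_zero _
  · rw [h₂, fst_sumTau, fst_sumTau, map_zero]
    rfl
  · rw [h₃, sumRho_sumTau, sumRho_sumTau, sumRho_sumTau, innerCDO_lie_innerCDO]
    rfl

theorem IsTwistedSum.isCouplingCrossedModule {Ξ : Coupling F K ℬ} (hcov : Covers nabla Ξ)
    (h : IsTwistedSum ℬ nabla 𝒜) (hℬ : ℬ.IsTransitive) :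
    IsCouplingCrossedModule sumTau 𝒜 (sumRho nabla) ℬ VBMap.fst := by
  obtain ⟨-, h₂, h₃⟩ := isTwistedSum_iff.1 h
  refine {
    transitive := fun x w => ?_
    tau_morphism := h.isLieAlgebroidMorphism_sumTau
    rho_representation := h.isRepresentation hcov
    rho_tau := fun V W => ?_
    tau_rho := fun X V => sumRho_injective (nabla := nabla) _ _ ?_ ?_
    cokernel := ⟨⟨fun x v => (h.anchor_eq x v).symm, h₂⟩, fun x v => ⟨(v, 0), rfl⟩, fun x => ?_⟩
    ker_tau := fun x => ?_ }
  · obtain ⟨v, hv⟩ := hℬ x w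
    exact ⟨(v, 0), (h.anchor_eq x _).trans hv⟩
  · rw [sumRho_sumTau]
    rfl
  · rw [h₂, fst_sumTau, fst_sumTau, map_zero]
  · rw [h₃, sumRho_sumTau, sumRho_sumTau, lie_innerCDO]
  · ext v
    constructor
    · intro hv
      obtain ⟨w, hw⟩ := AdFibre.ofFibre_surjective x v.2
      exact ⟨w, Prod.ext (LinearMap.mem_ker.1 hv).symm hw⟩
    · rintro ⟨w, rfl⟩
      rfl
  · ext v
    rw [LinearMap.mem_ker, LieSubmodule.mem_toSubmodule, LieModule.mem_maxTrivSubmodule]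
    have h0 : ((0 : B x), AdFibre.ofFibre x v) = 0 ↔ AdFibre.ofFibre x v = 0 :=
      ⟨fun h => congrArg Prod.snd h, fun h => Prod.ext rfl h⟩
    refine Iff.trans h0 ?_
    rw [← (AdFibre.toEnd_injective x).eq_iff, map_zero, LinearMap.ext_iff]
    refine forall_congr' fun w => ?_
    rw [AdFibre.toEnd_ofFibre, LinearMap.zero_apply, ← lie_skew, neg_eq_zero]

end Twisted

variable [FiniteDimensional ℝ FB] [ContMDiffVectorBundle ∞ FB B I]

/-- A coupling is covered by a Lie derivation law. -/
theorem Coupling.exists_covers (Ξ : Coupling F K ℬ) :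
    ∃ nabla : Cₛ^∞⟮I; FB, B⟯ →ₗ[C^∞⟮I, M; ℝ⟯] CDO I F K, Covers nabla Ξ := by
  refine exists_lift (Submodule.mkQ (LinearMap.range (innerCDO I F K)))
    (Submodule.mkQ_surjective _) CDO.lfSum (fun ρ χ hρ D => CDO.lfSum_smul_const ρ hρ D)
    (fun ρ D hD => ?_) Ξ.toLinearMap
  choose V hV using fun i => (Submodule.Quotient.mk_eq_zero _).1 (hD i)
  refine (Submodule.Quotient.mk_eq_zero _).2 ⟨lfSum ρ V, ?_⟩
  rw [← CDO.lfSum_innerCDO]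
  simp only [hV]

/-! ### Coupling crossed modules as fibre products -/

namespace IsCouplingCrossedModule

variable [FiniteDimensional ℝ FA] [ContMDiffVectorBundle ∞ FA A I]
  {τ : VBMap I F K FA A} {𝒜 : LieAlgebroid I FA A}
  {ρ : Cₛ^∞⟮I; FA, A⟯ →ₗ[C^∞⟮I, M; ℝ⟯] CDO I F K} {proj : VBMap I FA A FB B}

theorem exists_tau_eq (h : IsCouplingCrossedModule τ 𝒜 ρ ℬ proj) {a : Cₛ^∞⟮I; FA, A⟯}
    (ha : proj.onSections a = 0) : ∃ V, τ.onSections V = a :=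
  VBMap.exists_onSections_eq_of_exact τ proj h.cokernel.surjective h.cokernel.ker_eq ha

/-- An element of the kernel of both maps is `τ V` with `ad V = 0`, so `V` is central and `τ V = 0`.
-/
theorem jointly_injective (h : IsCouplingCrossedModule τ 𝒜 ρ ℬ proj) (a b : Cₛ^∞⟮I; FA, A⟯)
    (h₁ : proj.onSections a = proj.onSections b) (h₂ : ρ a = ρ b) : a = b := by
  obtain ⟨V, hV⟩ := h.exists_tau_eq (a := a - b) (by rw [map_sub, h₁, sub_self])
  have h0 : innerCDO I F K V = 0 := by rw [← h.rho_tau_eq, hV, map_sub, h₂, sub_self]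
  rw [← sub_eq_zero, ← hV]
  ext x
  have : V x ∈ LinearMap.ker (τ.toFun x) := by
    rw [h.ker_tau]
    exact innerCDO_eq_zero h0 x
  exact this

/-- The pairs `(X, D)` in the fibre product of `ℬ` and `CDO[K]` over `OutDO[K]` come from `A`. -/
theorem exists_proj_eq_rho_eq (h : IsCouplingCrossedModule τ 𝒜 ρ ℬ proj) {Ξ : Coupling F K ℬ}
    (hΞ : Induces ρ proj Ξ) (X : Cₛ^∞⟮I; FB, B⟯) (D : CDO I F K)
    (hD : (Submodule.Quotient.mk D : OutDO I F K) = Ξ.toLinearMap X) :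
    ∃ a, proj.onSections a = X ∧ ρ a = D := by
  obtain ⟨a, rfl⟩ := proj.onSections_surjective h.cokernel.surjective X
  rw [hΞ a, Submodule.Quotient.eq] at hD
  obtain ⟨V, hV⟩ := hD
  refine ⟨a + τ.onSections V, ?_, ?_⟩
  · rw [map_add, h.cokernel.proj_tau_eq, add_zero]
  · rw [map_add, h.rho_tau_eq, hV, add_sub_cancel]

/-- The induced coupling is `X ↦ [ρ (σ X)]` for any splitting `σ` of the projection. -/
theorem existsUnique_induces (h : IsCouplingCrossedModule τ 𝒜 ρ ℬ proj) :
    ∃! Ξ : Coupling F K ℬ, Induces ρ proj Ξ := by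
  obtain ⟨σ, hσ⟩ := proj.exists_rightInverse h.cokernel.surjective
  let L : Cₛ^∞⟮I; FB, B⟯ →ₗ[C^∞⟮I, M; ℝ⟯] OutDO I F K :=
    (Submodule.mkQ (LinearMap.range (innerCDO I F K))) ∘ₗ ρ ∘ₗ σ.onSections
  have hL : ∀ a, L (proj.onSections a) = (Submodule.Quotient.mk (ρ a) : OutDO I F K) := by
    intro a
    refine (Submodule.Quotient.eq _).2 ?_
    obtain ⟨V, hV⟩ := h.exists_tau_eq (a := σ.onSections (proj.onSections a) - a)
      (by rw [map_sub, hσ, sub_self])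
    refine ⟨V, ?_⟩
    rw [← h.rho_tau_eq, hV, map_sub]
    rfl
  have hsurj := proj.onSections_surjective h.cokernel.surjective
  refine ⟨⟨L, fun X => ?_, fun X Y => ?_⟩, hL, fun Ξ hΞ => ?_⟩
  · obtain ⟨a, rfl⟩ := hsurj X
    rw [hL]
    refine (h.rho_representation.symbol_eq a).trans ?_
    have : ℬ.anchor.onSections (proj.onSections a) = 𝒜.anchor.onSections a := by
      ext x
      exact h.cokernel.morphism.anchor_comp x (a x)
    change vectorFieldDerivation _ = vectorFieldDerivation (ℬ.anchor.onSections _)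
    rw [this]
  · obtain ⟨a, rfl⟩ := hsurj X
    obtain ⟨b, rfl⟩ := hsurj Y
    rw [← h.cokernel.morphism.map_bracket, hL, hL, hL, OutDO.mk_lie,
      h.rho_representation.map_bracket]
  · refine Coupling.ext (LinearMap.ext fun X => ?_)
    obtain ⟨a, rfl⟩ := hsurj X
    rw [hΞ a, hL]

variable {FA' : Type*} [NormedAddCommGroup FA'] [NormedSpace ℝ FA'] {A' : M → Type*}
  [TopologicalSpace (TotalSpace FA' A')] [∀ x, TopologicalSpace (A' x)] [FiberBundle FA' A']
  [∀ x, AddCommGroup (A' x)] [∀ x, Module ℝ (A' x)] [VectorBundle ℝ FA' A']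
  [FiniteDimensional ℝ FA'] [ContMDiffVectorBundle ∞ FA' A' I]
  {τ' : VBMap I F K FA' A'} {𝒜' : LieAlgebroid I FA' A'}
  {ρ' : Cₛ^∞⟮I; FA', A'⟯ →ₗ[C^∞⟮I, M; ℝ⟯] CDO I F K} {proj' : VBMap I FA' A' FB B}

/-- Both modules are the fibre product of `ℬ` and `CDO[K]` over `OutDO[K]`. -/
theorem areEquivalent (h : IsCouplingCrossedModule τ 𝒜 ρ ℬ proj)
    (h' : IsCouplingCrossedModule τ' 𝒜' ρ' ℬ proj') {Ξ : Coupling F K ℬ}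
    (hΞ : Induces ρ proj Ξ) (hΞ' : Induces ρ' proj' Ξ) :
    AreEquivalent τ 𝒜 ρ proj τ' 𝒜' ρ' proj' := by
  choose f hf₁ hf₂ using fun a =>
    h'.exists_proj_eq_rho_eq hΞ' (proj.onSections a) (ρ a) (hΞ a).symm
  let L : Cₛ^∞⟮I; FA, A⟯ →ₗ[C^∞⟮I, M; ℝ⟯] Cₛ^∞⟮I; FA', A'⟯ :=
    { toFun := f
      map_add' := fun a b => h'.jointly_injective _ _ (by simp only [map_add, hf₁])
        (by simp only [map_add, hf₂])
      map_smul' := fun g a => h'.jointly_injective _ _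
        (by simp only [map_smul, hf₁, RingHom.id_apply])
        (by simp only [map_smul, hf₂, RingHom.id_apply]) }
  obtain ⟨θ, hθ⟩ := exists_onSections_eq L
  have hθ₁ : ∀ a, proj'.onSections (θ.onSections a) = proj.onSections a := fun a => by
    rw [hθ]
    exact hf₁ a
  have hθ₂ : ∀ a, ρ' (θ.onSections a) = ρ a := fun a => by
    rw [hθ]
    exact hf₂ a
  have hθτ : ∀ V, θ.onSections (τ.onSections V) = τ'.onSections V := fun V =>
    h'.jointly_injective _ _
      (by rw [hθ₁, h.cokernel.proj_tau_eq,
        h'.cokernel.proj_tau_eq])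
      (by rw [hθ₂, h.rho_tau_eq, h'.rho_tau_eq])
  have hproj : ∀ x v, proj'.toFun x (θ.toFun x v) = proj.toFun x v := by
    intro x v
    obtain ⟨a, rfl⟩ := exists_section_apply_eq (I := I) (F := FA) v
    exact congrArg (fun s => s x) (hθ₁ a)
  refine ⟨θ, ⟨fun x v => ?_, fun a b => h'.jointly_injective _ _ ?_ ?_⟩, fun x v => ?_, hproj,
    hθ₂⟩
  · rw [← h.cokernel.morphism.anchor_comp, ← h'.cokernel.morphism.anchor_comp, hproj]
  · rw [hθ₁, h.cokernel.morphism.map_bracket, h'.cokernel.morphism.map_bracket, hθ₁, hθ₁]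
  · rw [hθ₂, h.rho_representation.map_bracket, h'.rho_representation.map_bracket, hθ₂, hθ₂]
  · obtain ⟨V, rfl⟩ := exists_section_apply_eq (I := I) (F := F) v
    exact congrArg (fun s => s x) (hθτ V)

theorem coupling_eq_of_areEquivalent (h : IsCouplingCrossedModule τ 𝒜 ρ ℬ proj)
    {Ξ Ξ' : Coupling F K ℬ} (hΞ : Induces ρ proj Ξ) (hΞ' : Induces ρ' proj' Ξ')
    (he : AreEquivalent τ 𝒜 ρ proj τ' 𝒜' ρ' proj') : Ξ = Ξ' := by
  obtain ⟨θ, -, -, hproj, hρ⟩ := he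
  refine Coupling.ext (LinearMap.ext fun X => ?_)
  obtain ⟨a, rfl⟩ := proj.onSections_surjective h.cokernel.surjective X
  have : proj.onSections a = proj'.onSections (θ.onSections a) := by
    ext x
    exact (hproj x (a x)).symm
  rw [hΞ, this, hΞ', hρ]

end IsCouplingCrossedModule

end Algebroids

end

end Algd

theorem mainTheorem11
    {E : Type*} [NormedAddCommGroup E] [NormedSpace ℝ E] [FiniteDimensional ℝ E]
    {H : Type*} [TopologicalSpace H] (I : ModelWithCorners ℝ E H)
    {M : Type*} [TopologicalSpace M] [ChartedSpace H M] [IsManifold I ∞ M]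
    [BoundarylessManifold I M] [T2Space M] [SigmaCompactSpace M]
    -- the Lie algebra bundle `K`
    (F : Type*) [NormedAddCommGroup F] [NormedSpace ℝ F] [FiniteDimensional ℝ F] (K : M → Type*)
    [TopologicalSpace (TotalSpace F K)] [∀ x, TopologicalSpace (K x)] [FiberBundle F K]
    [∀ x, LieRing (K x)] [∀ x, LieAlgebra ℝ (K x)] [VectorBundle ℝ F K]
    [ContMDiffVectorBundle ∞ F K I] [LieAlgebraBundle I F K]
    -- the Lie algebroid `ℬ` on the vector bundle `B`
    {FB : Type*} [NormedAddCommGroup FB] [NormedSpace ℝ FB] [FiniteDimensional ℝ FB]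
    {B : M → Type*} [TopologicalSpace (TotalSpace FB B)] [∀ x, TopologicalSpace (B x)]
    [FiberBundle FB B] [∀ x, AddCommGroup (B x)] [∀ x, Module ℝ (B x)] [VectorBundle ℝ FB B]
    [ContMDiffVectorBundle ∞ FB B I] (ℬ : LieAlgebroid I FB B) :
    -- from couplings to coupling crossed modules
    (∀ Ξ : Coupling F K ℬ,
      (∃ nabla : Cₛ^∞⟮I; FB, B⟯ →ₗ[C^∞⟮I, M; ℝ⟯] CDO I F K, Covers nabla Ξ) ∧
      ∀ nabla : Cₛ^∞⟮I; FB, B⟯ →ₗ[C^∞⟮I, M; ℝ⟯] CDO I F K, Covers nabla Ξ →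
        (∃! 𝒜 : LieAlgebroid I (FB × AdModel I F K) (B ×ᵇ AdFibre K),
          IsTwistedSum ℬ nabla 𝒜) ∧
        ∀ 𝒜 : LieAlgebroid I (FB × AdModel I F K) (B ×ᵇ AdFibre K), IsTwistedSum ℬ nabla 𝒜 →
          IsLieAlgebroidMorphism (LieAlgebraBundle.toLieAlgebroid I F K) 𝒜 sumTau ∧
          IsRepresentation 𝒜 (sumRho nabla) ∧
          Induces (sumRho nabla) VBMap.fst Ξ ∧
          (ℬ.IsTransitive →
            IsCouplingCrossedModule sumTau 𝒜 (sumRho nabla) ℬ VBMap.fst)) ∧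
    -- every coupling crossed module induces exactly one coupling
    (∀ {FA : Type*} [NormedAddCommGroup FA] [NormedSpace ℝ FA] [FiniteDimensional ℝ FA]
      {A : M → Type*} [TopologicalSpace (TotalSpace FA A)] [∀ x, TopologicalSpace (A x)]
      [FiberBundle FA A] [∀ x, AddCommGroup (A x)] [∀ x, Module ℝ (A x)] [VectorBundle ℝ FA A]
      [ContMDiffVectorBundle ∞ FA A I]
      (τ : VBMap I F K FA A) (𝒜 : LieAlgebroid I FA A)
      (ρ : Cₛ^∞⟮I; FA, A⟯ →ₗ[C^∞⟮I, M; ℝ⟯] CDO I F K) (proj : VBMap I FA A FB B),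
      IsCouplingCrossedModule τ 𝒜 ρ ℬ proj → ∃! Ξ : Coupling F K ℬ, Induces ρ proj Ξ) ∧
    -- two coupling crossed modules induce the same coupling exactly if they are equivalent
    (∀ {FA : Type*} [NormedAddCommGroup FA] [NormedSpace ℝ FA] [FiniteDimensional ℝ FA]
      {A : M → Type*} [TopologicalSpace (TotalSpace FA A)] [∀ x, TopologicalSpace (A x)]
      [FiberBundle FA A] [∀ x, AddCommGroup (A x)] [∀ x, Module ℝ (A x)] [VectorBundle ℝ FA A]
      [ContMDiffVectorBundle ∞ FA A I]
      {FA' : Type*} [NormedAddCommGroup FA'] [NormedSpace ℝ FA'] [FiniteDimensional ℝ FA']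
      {A' : M → Type*} [TopologicalSpace (TotalSpace FA' A')] [∀ x, TopologicalSpace (A' x)]
      [FiberBundle FA' A'] [∀ x, AddCommGroup (A' x)] [∀ x, Module ℝ (A' x)]
      [VectorBundle ℝ FA' A'] [ContMDiffVectorBundle ∞ FA' A' I]
      (τ : VBMap I F K FA A) (𝒜 : LieAlgebroid I FA A)
      (ρ : Cₛ^∞⟮I; FA, A⟯ →ₗ[C^∞⟮I, M; ℝ⟯] CDO I F K) (proj : VBMap I FA A FB B)
      (τ' : VBMap I F K FA' A') (𝒜' : LieAlgebroid I FA' A')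
      (ρ' : Cₛ^∞⟮I; FA', A'⟯ →ₗ[C^∞⟮I, M; ℝ⟯] CDO I F K) (proj' : VBMap I FA' A' FB B)
      (Ξ Ξ' : Coupling F K ℬ),
      IsCouplingCrossedModule τ 𝒜 ρ ℬ proj → IsCouplingCrossedModule τ' 𝒜' ρ' ℬ proj' →
      Induces ρ proj Ξ → Induces ρ' proj' Ξ' →
      (AreEquivalent τ 𝒜 ρ proj τ' 𝒜' ρ' proj' ↔ Ξ = Ξ')) := by
  refine ⟨fun Ξ => ⟨Ξ.exists_covers, fun nabla hcov => ⟨existsUnique_isTwistedSum hcov,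
    fun 𝒜 h => ⟨h.isLieAlgebroidMorphism_sumTau, h.isRepresentation hcov,
      fun a => (mk_sumRho hcov a).symm, h.isCouplingCrossedModule hcov⟩⟩⟩, ?_, ?_⟩
  · intro FA _ _ _ A _ _ _ _ _ _ _ τ 𝒜 ρ proj h
    exact h.existsUnique_induces
  · intro FA _ _ _ A _ _ _ _ _ _ _ FA' _ _ _ A' _ _ _ _ _ _ _ τ 𝒜 ρ proj τ' 𝒜' ρ' proj' Ξ Ξ' h h'
      hΞ hΞ'
    refine ⟨h.coupling_eq_of_areEquivalent hΞ hΞ', ?_⟩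
    rintro rfl
    exact h.areEquivalent h' hΞ hΞ'
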